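/- Let $q$ be a prime power with $3 \mid q-1$, let $\alpha$ be a primitive element of the finite field $\mathbb{F}_q$, and let $S=\langle\alpha^3\rangle$ be the subgroup of index $3$ in $\mathbb{F}_q^*$. Let $R_0,R_1,R_2,R_3$ be the relations of the $3$-class cyclotomic scheme on $\mathbb{F}_q$: $R_0$ is the identity relation, and $(x,y)\in R_i$ if and only if $x-y\in\alpha^iS$, for $i\in\{1,2,3\}$ (these relations are symmetric). For $i\in\{1,2,3\}$, let $\Gamma_i$ be the graph on $\mathbb{F}_q$ with adjacency relation $R_i$, and let $\overline{\Gamma_i}$ be the graph on $\mathbb{F}_q$ with adjacency relation $R_j\cup R_k$, where $\{i,j,k\}=\{1,2,3\}$. A graph is a Deza graph with parameters $(n,k,b,a)$, $0\le a\le b\le k<n$, if it has $n$ vertices, is regular of valency $k$, and the number of common neighbours of two distinct vertices is always $a$ or $b$, both values being attained. It is strictly Deza if, moreover, it has diameter $2$ and is not strongly regular. For a subset $T$ of an additive group $G$ with $0\notin T=-T$, $\mathrm{Cay}(G,T)$ is the graph on $G$ in which $x,y$ are adjacent if and only if $x-y\in T$. Then the following statements hold. (1) For every $i\in\{1,2,3\}$,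 $\Gamma_i=\mathrm{Cay}(\mathbb{F}_q^+,\alpha^iS)$ and $\overline{\Gamma_i}=\mathrm{Cay}(\mathbb{F}_q^+,\mathbb{F}_q^*\setminus\alpha^iS)$, where both connection sets avoid $0$ and are closed under negation; $\mathbb{F}_q^*\setminus\alpha^iS$ generates $\mathbb{F}_q^+$, and so does $\alpha^iS$ if $q\neq4$. (2) The graphs $\Gamma_1,\Gamma_2,\Gamma_3$ are isomorphic. (3) The graphs $\overline{\Gamma_1},\overline{\Gamma_2},\overline{\Gamma_3}$ are isomorphic. (4) The graph $\Gamma_1$ is strictly Deza if and only if $q$ is prime, $q\ne7$, and $q=x^2+3$ for some integer $x$. (5) The graph $\overline{\Gamma_3}$ is strictly Deza if and only if $q$ is prime and $q=x^2+12$ for some integer $x$. -/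

import Mathlib

namespace DezaCyclotomic

/-- A Deza graph with parameters `(n, k, b, a)`: it has `n` vertices, is regular of valency `k`, and
the numbers of common neighbours of two distinct vertices are `a` or `b`, both being attained. -/
structure IsDezaWith {V : Type*} [Fintype V] (G : SimpleGraph V) (n k b a : ℕ) : Prop where
  a_le_b : a ≤ b
  b_le_k : b ≤ k
  k_lt_n : k < n
  card : Fintype.card V = n
  regular : ∀ v, (G.neighborSet v).ncard = k
  commonNeighbors : ∀ u v, u ≠ v →
    (G.commonNeighbors u v).ncard = a ∨ (G.commonNeighbors u v).ncard = b
  exists_a : ∃ u v, u ≠ v ∧ (G.commonNeighbors u v).ncard = a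
  exists_b : ∃ u v, u ≠ v ∧ (G.commonNeighbors u v).ncard = b

open Classical in
/-- A graph that is strongly regular for some parameters. -/
def IsStronglyRegular {V : Type*} [Fintype V] (G : SimpleGraph V) : Prop :=
  ∃ n k l m : ℕ, G.IsSRGWith n k l m

/-- A strictly Deza graph: a Deza graph that has diameter `2` and is not strongly regular. -/
def IsStrictlyDeza {V : Type*} [Fintype V] (G : SimpleGraph V) : Prop :=
  (∃ n k b a : ℕ, IsDezaWith G n k b a) ∧ G.ediam = 2 ∧ ¬ IsStronglyRegular G

/-- The coset `α ^ i ⟨α ^ e⟩` of the subgroup generated by `α ^ e`, as a subset of the field. -/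
def cyclotomicCoset {F : Type*} [Field F] (α : Fˣ) (e i : ℕ) : Set F :=
  {x | ∃ s ∈ Subgroup.zpowers (α ^ e), x = ((α ^ i * s : Fˣ) : F)}

/-- The relations `R_0, R_1, …, R_e` of the cyclotomic scheme of class `e` for the
primitive element `α`. -/
def cyclotomicRel {F : Type*} [Field F] (α : Fˣ) (e : ℕ) : ℕ → F → F → Prop
  | 0, x, y => x = y
  | i + 1, x, y => x - y ∈ cyclotomicCoset α e (i + 1)

theorem neg_mem_cyclotomicCoset_three {F : Type*} [Field F] {α : Fˣ}
    (hα : ∀ u : Fˣ, u ∈ Subgroup.zpowers α) {i : ℕ} {x : F}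
    (hx : x ∈ cyclotomicCoset α 3 i) : -x ∈ cyclotomicCoset α 3 i := by
  obtain ⟨s, hs, rfl⟩ := hx
  obtain ⟨k, hk⟩ := hα (-1)
  have h1 : (-1 : Fˣ) ∈ Subgroup.zpowers (α ^ 3) := by
    refine ⟨k, ?_⟩
    have h2 : (α ^ 3) ^ k = (α ^ k) ^ 3 := by
      rw [← zpow_natCast, ← zpow_mul, mul_comm, zpow_mul, zpow_natCast]
    simp only at hk ⊢
    rw [h2, hk]
    norm_num
  exact ⟨(-1) * s, mul_mem h1 hs, by push_cast; ring⟩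

/-- The cyclotomic scheme of class `3` is symmetric. -/
theorem cyclotomicRel_three_symm {F : Type*} [Field F] {α : Fˣ}
    (hα : ∀ u : Fˣ, u ∈ Subgroup.zpowers α) (i : ℕ) {x y : F}
    (h : cyclotomicRel α 3 i x y) : cyclotomicRel α 3 i y x := by
  cases i with
  | zero => exact Eq.symm h
  | succ i =>
    have h1 := neg_mem_cyclotomicCoset_three hα (show x - y ∈ _ from h)
    rw [neg_sub] at h1
    exact h1

/-- The graph on `F` whose adjacency relation is the union of the relations `R_j`, `j ∈ J`, of the
cyclotomic scheme of class `3`. The condition `x ≠ y` only disregards the identity relation `R_0`,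
and it is automatic for the others. -/
def schemeGraph {F : Type*} [Field F] (α : Fˣ) (hα : ∀ u : Fˣ, u ∈ Subgroup.zpowers α)
    (J : Set ℕ) : SimpleGraph F where
  Adj x y := x ≠ y ∧ ∃ j ∈ J, cyclotomicRel α 3 j x y
  symm := ⟨fun _ _ ⟨h, j, hj, hr⟩ => ⟨h.symm, j, hj, cyclotomicRel_three_symm hα j hr⟩⟩
  loopless := ⟨fun _ h => h.1 rfl⟩

/-- The graph `Γ_i` with adjacency relation `R_i`, `i ∈ {1, 2, 3}`. -/
def Gam {F : Type*} [Field F] (α : Fˣ) (hα : ∀ u : Fˣ, u ∈ Subgroup.zpowers α) (i : ℕ) :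
    SimpleGraph F :=
  schemeGraph α hα {i}

/-- The graph `Γ̄_i` with adjacency relation `R_j ∪ R_k`, where `{i, j, k} = {1, 2, 3}`. -/
def GamBar {F : Type*} [Field F] (α : Fˣ) (hα : ∀ u : Fˣ, u ∈ Subgroup.zpowers α) (i : ℕ) :
    SimpleGraph F :=
  schemeGraph α hα ({1, 2, 3} \ {i})

/-- `x, y` are adjacent in the Cayley graph of an additive group with respect to `S`
iff `x - y ∈ S`; this is a graph if `0 ∉ S` and `-S = S`. -/
def IsCayleyGraph {A : Type*} [AddGroup A] (G : SimpleGraph A) (S : Set A) : Prop :=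
  (0 : A) ∉ S ∧ (∀ x ∈ S, -x ∈ S) ∧ ∀ x y, G.Adj x y ↔ x - y ∈ S

end DezaCyclotomic

/-! Let f = (q - 1)/3. Multiplication by α permutes the three cosets of S cyclically, and -1 is a
cube. Hence the number of ways to write an element of one coset as a sum over two given cosets takes
only four values A, B, C, D (`IsInterNumbers`). Two row sums give D = A + 1, and associativity of
convolution gives one quadratic relation, which amounts to 4q = c² + 27d² with c = 9A - q + 8 and d
= C - B.

In Γ_1 adjacent vertices have A common neighbours and nonadjacent ones B or C, so strictly Deza
means B ≠ C, A ∈ {B, C} and B, C > 0. In Γ̄_3 nonadjacent vertices have f + 1 + A and adjacent ones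
f - 1 + B or f - 1 + C, so the condition is B ≠ C and A + 2 ∈ {B, C}. Putting these equalities into
the quadratic relation gives q = x² + 3, respectively q = x² + 12. Conversely, for prime q the
representation 4q = c² + 27d² is unique up to signs (`sq_eq_sq_of_four_mul_eq`) and c ≡ 1 mod 3
fixes the sign of c. So a representation of q by x² + 3 or x² + 12 determines A and {B, C}.

It remains to see that a prime power pⁿ of either form is prime, apart from 4 and 16. For p ≥ 5 an
even n would give two squares too close together. For odd n, p = a² + 3b² and factorisation in
ℤ[√-3] give Im (a + b√-3)ⁿ = ±y with y = 1 or 2, and then b = ±y. After normalising to b = y, the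
value +y forces n = 1 by a 3-adic argument (`eq_one_of_pow_im_eq`). The value -y is impossible
modulo 4 if y = 1 (`pow_im_ne_neg_one`), and by a Jacobi symbol if y = 2 (`pow_im_ne_neg_two`). -/

namespace DezaCyclotomic

/-! ### Cosets of the cubes. -/

section Cosets

variable {F : Type*} [Field F] {α : Fˣ}

theorem zero_notMem_cyclotomicCoset (i : ℕ) : (0 : F) ∉ cyclotomicCoset α 3 i := by
  rintro ⟨s, -, hs⟩
  exact (α ^ i * s).ne_zero hs.symm

theorem cyclotomicCoset_add_three (i : ℕ) :
    cyclotomicCoset α 3 (i + 3) = cyclotomicCoset α 3 i := by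
  have h3 : α ^ 3 ∈ Subgroup.zpowers (α ^ 3) := Subgroup.mem_zpowers _
  ext x
  constructor
  · rintro ⟨s, hs, rfl⟩
    exact ⟨α ^ 3 * s, mul_mem h3 hs, by rw [pow_add, mul_assoc]⟩
  · rintro ⟨s, hs, rfl⟩
    exact ⟨(α ^ 3)⁻¹ * s, mul_mem (inv_mem h3) hs, by rw [pow_add]; group⟩

theorem mul_mem_cyclotomicCoset_iff {x y : F} {i k : ℕ} (hy : y ∈ cyclotomicCoset α 3 k) :
    y * x ∈ cyclotomicCoset α 3 (i + k) ↔ x ∈ cyclotomicCoset α 3 i := by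
  obtain ⟨s, hs, rfl⟩ := hy
  constructor
  · rintro ⟨t, ht, h⟩
    refine ⟨s⁻¹ * t, mul_mem (inv_mem hs) ht, ?_⟩
    apply mul_left_cancel₀ (α ^ k * s).ne_zero
    rw [h, ← Units.val_mul]
    congr 1
    rw [pow_add, mul_comm (α ^ i), mul_assoc, mul_assoc, mul_left_comm s, mul_inv_cancel_left]
  · rintro ⟨t, ht, rfl⟩
    refine ⟨s * t, mul_mem hs ht, ?_⟩
    rw [← Units.val_mul]
    congr 1
    rw [pow_add, mul_mul_mul_comm, mul_comm (α ^ k)]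

theorem pow_mem_cyclotomicCoset (i : ℕ) : ((α ^ i : Fˣ) : F) ∈ cyclotomicCoset α 3 i :=
  ⟨1, one_mem _, by simp⟩

theorem exists_zpow_eq (hα : ∀ u : Fˣ, u ∈ Subgroup.zpowers α) {x : F} (hx : x ≠ 0) :
    ∃ n : ℤ, x = ((α ^ n : Fˣ) : F) := by
  obtain ⟨n, hn⟩ := hα (Units.mk0 x hx)
  refine ⟨n, ?_⟩
  simp only at hn
  rw [hn]
  rfl

variable [Fintype F]

theorem zpow_mem_cyclotomicCoset_iff (h3 : 3 ∣ Fintype.card F - 1)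
    (hα : ∀ u : Fˣ, u ∈ Subgroup.zpowers α) (n : ℤ) (i : ℕ) :
    ((α ^ n : Fˣ) : F) ∈ cyclotomicCoset α 3 i ↔ (3 : ℤ) ∣ n - i := by
  classical
  have ho : orderOf α = Fintype.card F - 1 := by
    rw [orderOf_eq_card_of_forall_mem_zpowers hα, Nat.card_eq_fintype_card, Fintype.card_units]
  constructor
  · rintro ⟨s, ⟨k, rfl⟩, h⟩
    have h1 : α ^ (n - i - 3 * k) = 1 := by
      have h2 : α ^ n = α ^ i * (α ^ 3) ^ k := Units.ext h
      rw [zpow_sub, zpow_sub, h2, zpow_mul, zpow_natCast]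
      rw [show (α ^ (3 : ℤ)) = α ^ 3 from zpow_ofNat α 3]
      group
    have h2 := orderOf_dvd_iff_zpow_eq_one.2 h1
    rw [ho] at h2
    have h4 : (3 : ℤ) ∣ n - i - 3 * k := (Int.natCast_dvd_natCast.2 h3).trans h2
    omega
  · rintro ⟨k, hk⟩
    refine ⟨(α ^ 3) ^ k, ⟨k, rfl⟩, ?_⟩
    congr 1
    rw [show n = i + 3 * k by omega, zpow_add, zpow_mul, zpow_natCast]
    rfl

end Cosets

/-! ### Intersection numbers and their relations. -/

section Counting

open Classical in
/-- The indicator function of the coset `α ^ i ⟨α ^ 3⟩`. -/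
noncomputable def cosetInd {F : Type*} [Field F] (α : Fˣ) (i : ℕ) (x : F) : ℤ :=
  if x ∈ cyclotomicCoset α 3 i then 1 else 0

/-- The number of representations of `z` as a sum of an element of the `i`-th coset and an element
of the `j`-th one. -/
noncomputable def sumCount {F : Type*} [Field F] [Fintype F] (α : Fˣ) (i j : ℕ) (z : F) : ℤ :=
  ∑ x, cosetInd α i x * cosetInd α j (z - x)

/-- The common size of the cosets. -/
noncomputable def cosetSize {F : Type*} [Field F] [Fintype F] (α : Fˣ) : ℤ :=
  ∑ x : F, cosetInd α 0 x

/-- The intersection numbers of the cyclotomic scheme of class `3`. -/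
noncomputable def interNum {F : Type*} [Field F] [Fintype F] (α : Fˣ) (i j k : ℕ) : ℤ :=
  sumCount α i j ((α ^ k : Fˣ) : F)

variable {F : Type*} [Field F] {α : Fˣ}

theorem cosetInd_of_mem {i : ℕ} {x : F} (h : x ∈ cyclotomicCoset α 3 i) : cosetInd α i x = 1 :=
  if_pos h

theorem cosetInd_of_notMem {i : ℕ} {x : F} (h : x ∉ cyclotomicCoset α 3 i) :
    cosetInd α i x = 0 :=
  if_neg h

theorem cosetInd_zero (i : ℕ) : cosetInd α i (0 : F) = 0 :=
  cosetInd_of_notMem (zero_notMem_cyclotomicCoset i)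

theorem cosetInd_add_three (i : ℕ) (x : F) : cosetInd α (i + 3) x = cosetInd α i x := by
  unfold cosetInd
  rw [cyclotomicCoset_add_three]

theorem cosetInd_mul {x y : F} {i k : ℕ} (hy : y ∈ cyclotomicCoset α 3 k) :
    cosetInd α (i + k) (y * x) = cosetInd α i x := by
  unfold cosetInd
  rw [mul_mem_cyclotomicCoset_iff hy]

theorem cosetInd_neg (hα : ∀ u : Fˣ, u ∈ Subgroup.zpowers α) (i : ℕ) (x : F) :
    cosetInd α i (-x) = cosetInd α i x := by
  unfold cosetInd
  have h : -x ∈ cyclotomicCoset α 3 i ↔ x ∈ cyclotomicCoset α 3 i :=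
    ⟨fun h => by simpa using neg_mem_cyclotomicCoset_three hα h,
      fun h => neg_mem_cyclotomicCoset_three hα h⟩
  rw [h]

variable [Fintype F]

theorem cosetInd_zpow (h3 : 3 ∣ Fintype.card F - 1) (hα : ∀ u : Fˣ, u ∈ Subgroup.zpowers α)
    (n : ℤ) (i : ℕ) :
    cosetInd α i ((α ^ n : Fˣ) : F) = if (3 : ℤ) ∣ n - i then 1 else 0 := by
  unfold cosetInd
  simp only [zpow_mem_cyclotomicCoset_iff h3 hα]

theorem cosetInd_pow (h3 : 3 ∣ Fintype.card F - 1) (hα : ∀ u : Fˣ, u ∈ Subgroup.zpowers α)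
    (n i : ℕ) :
    cosetInd α i ((α ^ n : Fˣ) : F) = if (3 : ℤ) ∣ (n : ℤ) - i then 1 else 0 := by
  rw [← cosetInd_zpow h3 hα, zpow_natCast]

theorem cosetInd_sum (h3 : 3 ∣ Fintype.card F - 1) (hα : ∀ u : Fˣ, u ∈ Subgroup.zpowers α)
    {x : F} (hx : x ≠ 0) : cosetInd α 0 x + cosetInd α 1 x + cosetInd α 2 x = 1 := by
  obtain ⟨n, rfl⟩ := exists_zpow_eq hα hx
  simp only [cosetInd_zpow h3 hα]
  have : n % 3 = 0 ∨ n % 3 = 1 ∨ n % 3 = 2 := by omega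
  split_ifs <;> push_cast at * <;> omega

theorem cosetInd_mul_cosetInd (h3 : 3 ∣ Fintype.card F - 1)
    (hα : ∀ u : Fˣ, u ∈ Subgroup.zpowers α) (x : F) (i j : ℕ) :
    cosetInd α i x * cosetInd α j x = if (3 : ℤ) ∣ (i : ℤ) - j then cosetInd α i x else 0 := by
  by_cases hx : x = 0
  · subst hx
    simp [cosetInd_zero]
  obtain ⟨n, rfl⟩ := exists_zpow_eq hα hx
  simp only [cosetInd_zpow h3 hα]
  split_ifs <;> omega

theorem sum_cosetInd (i : ℕ) : ∑ x : F, cosetInd α i x = cosetSize α := by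
  unfold cosetSize
  rw [← Equiv.sum_comp (Equiv.mulLeft₀ (((α ^ i : Fˣ) : F)) (α ^ i).ne_zero) (cosetInd α i)]
  refine Finset.sum_congr rfl fun x _ => ?_
  have := cosetInd_mul (x := x) (i := 0) (pow_mem_cyclotomicCoset (α := α) i)
  rw [zero_add] at this
  exact this

theorem three_mul_cosetSize (h3 : 3 ∣ Fintype.card F - 1)
    (hα : ∀ u : Fˣ, u ∈ Subgroup.zpowers α) :
    3 * cosetSize (F := F) α + 1 = Fintype.card F := by
  classical
  have h : ∀ x : F, cosetInd α 0 x + cosetInd α 1 x + cosetInd α 2 x + (if x = 0 then 1 else 0)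
      = 1 := by
    intro x
    split_ifs with hx
    · simp [hx, cosetInd_zero]
    · rw [cosetInd_sum h3 hα hx, add_zero]
  have h2 := Finset.sum_congr (rfl : (Finset.univ : Finset F) = _) fun x _ => h x
  simp only [Finset.sum_add_distrib, sum_cosetInd, Finset.sum_ite_eq', Finset.mem_univ, if_true,
    Finset.sum_const, Finset.card_univ, nsmul_eq_mul, mul_one] at h2
  linarith

theorem cosetSize_pos (h3 : 3 ∣ Fintype.card F - 1)
    (hα : ∀ u : Fˣ, u ∈ Subgroup.zpowers α) : 0 < cosetSize (F := F) α := by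
  have := three_mul_cosetSize h3 hα
  have h1 : 1 < Fintype.card F := Fintype.one_lt_card
  omega

theorem sumCount_comm (i j : ℕ) (z : F) : sumCount α i j z = sumCount α j i z := by
  unfold sumCount
  rw [← Equiv.sum_comp (Equiv.subLeft z)]
  refine Finset.sum_congr rfl fun x _ => ?_
  simp [mul_comm]

theorem sumCount_mul {y : F} {k : ℕ} (hy : y ∈ cyclotomicCoset α 3 k) (i j : ℕ) (z : F) :
    sumCount α (i + k) (j + k) (y * z) = sumCount α i j z := by
  have hy0 : y ≠ 0 := fun h => zero_notMem_cyclotomicCoset k (h ▸ hy)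
  unfold sumCount
  rw [← Equiv.sum_comp (Equiv.mulLeft₀ y hy0)]
  refine Finset.sum_congr rfl fun x _ => ?_
  change cosetInd α (i + k) (y * x) * cosetInd α (j + k) (y * z - y * x) = _
  rw [← mul_sub, cosetInd_mul hy, cosetInd_mul hy]

theorem sumCount_zero (h3 : 3 ∣ Fintype.card F - 1)
    (hα : ∀ u : Fˣ, u ∈ Subgroup.zpowers α) (i j : ℕ) :
    sumCount α i j (0 : F) = if (3 : ℤ) ∣ (i : ℤ) - j then cosetSize (F := F) α else 0 := by
  unfold sumCount
  simp only [zero_sub, cosetInd_neg hα, cosetInd_mul_cosetInd h3 hα]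
  split_ifs
  · exact sum_cosetInd i
  · simp

theorem interNum_shift (i j k : ℕ) :
    interNum (F := F) α (i + 1) (j + 1) (k + 1) = interNum (F := F) α i j k := by
  have h := sumCount_mul (pow_mem_cyclotomicCoset (α := α) 1) i j ((α ^ k : Fˣ) : F)
  unfold interNum
  rw [← h, ← Units.val_mul, ← pow_add, add_comm 1 k]

/-- Scaling by an element of S preserves every coset, so the count depends only on the coset of z.
-/
theorem sumCount_of_mem {k : ℕ} {z : F} (hz : z ∈ cyclotomicCoset α 3 k) (i j : ℕ) :
    sumCount α i j z = interNum (F := F) α i j k := by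
  obtain ⟨s, hs, rfl⟩ := hz
  have h := sumCount_mul (k := 0) (y := ((s : Fˣ) : F)) ⟨s, hs, by simp⟩ i j ((α ^ k : Fˣ) : F)
  rw [interNum, ← h, ← Units.val_mul, mul_comm s]
  rfl

/-- Double counting of the solutions of x + y = z with x, y, z in the three cosets; this form
exposes the symmetry in the three indices. -/
theorem cosetSize_mul_interNum (i j k : ℕ) :
    cosetSize (F := F) α * interNum (F := F) α i j k =
      ∑ x : F, ∑ y : F, cosetInd α i x * cosetInd α j y * cosetInd α k (x + y) := by
  have h : ∀ z : F, cosetInd α k z * sumCount α i j z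
      = cosetInd α k z * interNum (F := F) α i j k := by
    intro z
    by_cases hz : z ∈ cyclotomicCoset α 3 k
    · rw [sumCount_of_mem hz]
    · rw [cosetInd_of_notMem hz, zero_mul, zero_mul]
  rw [← sum_cosetInd k, Finset.sum_mul, ← Finset.sum_congr rfl fun z _ => h z]
  simp only [sumCount, Finset.mul_sum]
  rw [Finset.sum_comm]
  refine Finset.sum_congr rfl fun x _ => ?_
  rw [← Equiv.sum_comp (Equiv.addLeft x)]
  refine Finset.sum_congr rfl fun y _ => ?_
  simp only [Equiv.coe_addLeft, add_sub_cancel_left]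
  ring

theorem interNum_comm (i j k : ℕ) :
    interNum (F := F) α i j k = interNum (F := F) α j i k :=
  sumCount_comm i j _

/-- Since the cosets are closed under negation, y ↦ -x - y exchanges the conditions on y and on x +
y. -/
theorem interNum_comm_right (h3 : 3 ∣ Fintype.card F - 1)
    (hα : ∀ u : Fˣ, u ∈ Subgroup.zpowers α) (i j k : ℕ) :
    interNum (F := F) α i j k = interNum (F := F) α i k j := by
  apply mul_left_cancel₀ (cosetSize_pos h3 hα).ne'
  rw [cosetSize_mul_interNum, cosetSize_mul_interNum]
  refine Finset.sum_congr rfl fun x _ => ?_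
  rw [← Equiv.sum_comp (Equiv.subLeft (-x))]
  refine Finset.sum_congr rfl fun y _ => ?_
  simp only [Equiv.subLeft_apply]
  rw [show x + (-x - y) = -y by ring, show -x - y = -(x + y) by ring, cosetInd_neg hα,
    cosetInd_neg hα]
  ring

theorem sumCount_eq (h3 : 3 ∣ Fintype.card F - 1)
    (hα : ∀ u : Fˣ, u ∈ Subgroup.zpowers α) (i j : ℕ) {z : F} (hz : z ≠ 0) :
    sumCount α i j z = interNum (F := F) α i j 0 * cosetInd α 0 z +
      interNum (F := F) α i j 1 * cosetInd α 1 z + interNum (F := F) α i j 2 * cosetInd α 2 z := by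
  have key : ∀ k, sumCount α i j z * cosetInd α k z
      = interNum (F := F) α i j k * cosetInd α k z := by
    intro k
    by_cases hk : z ∈ cyclotomicCoset α 3 k
    · rw [sumCount_of_mem hk]
    · rw [cosetInd_of_notMem hk, mul_zero, mul_zero]
  rw [← key, ← key, ← key, ← mul_add, ← mul_add, cosetInd_sum h3 hα hz, mul_one]

/-- Each x in the i-th coset is counted once, by the coset of z - x, except x = z, which leaves 0.
-/
theorem interNum_row_sum (h3 : 3 ∣ Fintype.card F - 1)
    (hα : ∀ u : Fˣ, u ∈ Subgroup.zpowers α) (i k : ℕ) :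
    interNum (F := F) α i 0 k + interNum (F := F) α i 1 k + interNum (F := F) α i 2 k =
      cosetSize (F := F) α - if (3 : ℤ) ∣ (k : ℤ) - i then 1 else 0 := by
  classical
  unfold interNum sumCount
  set z := ((α ^ k : Fˣ) : F) with hz
  rw [← Finset.sum_add_distrib, ← Finset.sum_add_distrib, ← cosetInd_pow h3 hα, ← hz,
    ← sum_cosetInd i]
  have h : ∀ x : F, cosetInd α i x * cosetInd α 0 (z - x) + cosetInd α i x * cosetInd α 1 (z - x)
      + cosetInd α i x * cosetInd α 2 (z - x)
      = cosetInd α i x - if x = z then cosetInd α i x else 0 := by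
    intro x
    split_ifs with hx
    · simp [hx, cosetInd_zero]
    · rw [← mul_add, ← mul_add, cosetInd_sum h3 hα (sub_ne_zero.2 (Ne.symm hx))]
      ring
  rw [Finset.sum_congr rfl fun x _ => h x, Finset.sum_sub_distrib]
  simp

/-- Associativity of convolution for the three indicator functions. -/
theorem sum_sumCount_mul (i j k : ℕ) (z : F) :
    ∑ s : F, sumCount α i j s * cosetInd α k (z - s) =
      ∑ x : F, cosetInd α i x * sumCount α j k (z - x) := by
  simp only [sumCount, Finset.sum_mul, Finset.mul_sum]
  rw [Finset.sum_comm]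
  refine Finset.sum_congr rfl fun x _ => ?_
  rw [← Equiv.sum_comp (Equiv.addLeft x)]
  refine Finset.sum_congr rfl fun y _ => ?_
  simp only [Equiv.coe_addLeft, add_sub_cancel_left]
  rw [sub_add_eq_sub_sub]
  ring

theorem sum_sumCount_mul_cosetInd (h3 : 3 ∣ Fintype.card F - 1)
    (hα : ∀ u : Fˣ, u ∈ Subgroup.zpowers α) (i j k : ℕ) (z : F) :
    ∑ s : F, sumCount α i j s * cosetInd α k (z - s) =
      sumCount α i j (0 : F) * cosetInd α k z + interNum (F := F) α i j 0 * sumCount α 0 k z +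
      interNum (F := F) α i j 1 * sumCount α 1 k z +
      interNum (F := F) α i j 2 * sumCount α 2 k z := by
  classical
  have h : ∀ s : F, sumCount α i j s * cosetInd α k (z - s) =
      (if s = 0 then sumCount α i j (0 : F) * cosetInd α k z else 0) +
      interNum (F := F) α i j 0 * (cosetInd α 0 s * cosetInd α k (z - s)) +
      interNum (F := F) α i j 1 * (cosetInd α 1 s * cosetInd α k (z - s)) +
      interNum (F := F) α i j 2 * (cosetInd α 2 s * cosetInd α k (z - s)) := by
    intro s
    split_ifs with hs
    · simp [hs, cosetInd_zero]
    · rw [sumCount_eq h3 hα i j hs]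
      ring
  rw [Finset.sum_congr rfl fun s _ => h s]
  simp only [Finset.sum_add_distrib, ← Finset.mul_sum, Finset.sum_ite_eq', Finset.mem_univ,
    if_true]
  rfl

/-- Associativity of the intersection algebra. -/
theorem interNum_assoc (h3 : 3 ∣ Fintype.card F - 1)
    (hα : ∀ u : Fˣ, u ∈ Subgroup.zpowers α) (i j k l : ℕ) :
    sumCount α i j (0 : F) * cosetInd α k ((α ^ l : Fˣ) : F) +
      interNum (F := F) α i j 0 * interNum (F := F) α 0 k l +
      interNum (F := F) α i j 1 * interNum (F := F) α 1 k l +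
      interNum (F := F) α i j 2 * interNum (F := F) α 2 k l =
    sumCount α j k (0 : F) * cosetInd α i ((α ^ l : Fˣ) : F) +
      interNum (F := F) α j k 0 * interNum (F := F) α 0 i l +
      interNum (F := F) α j k 1 * interNum (F := F) α 1 i l +
      interNum (F := F) α j k 2 * interNum (F := F) α 2 i l := by
  have h := sum_sumCount_mul (α := α) i j k ((α ^ l : Fˣ) : F)
  have h' : ∑ x : F, cosetInd α i x * sumCount α j k (((α ^ l : Fˣ) : F) - x) =
      ∑ s : F, sumCount α j k s * cosetInd α i (((α ^ l : Fˣ) : F) - s) := by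
    rw [← Equiv.sum_comp (Equiv.subLeft ((α ^ l : Fˣ) : F))]
    refine Finset.sum_congr rfl fun x _ => ?_
    simp [mul_comm]
  rw [h', sum_sumCount_mul_cosetInd h3 hα, sum_sumCount_mul_cosetInd h3 hα] at h
  exact h

theorem interNum_add_three (i j k : ℕ) :
    interNum (F := F) α (i + 3) j (k + 3) = interNum (F := F) α i j k ∧
    interNum (F := F) α i j (k + 3) = interNum (F := F) α i j k := by
  have h : interNum (F := F) α i j (k + 3) = interNum (F := F) α i j k :=
    sumCount_of_mem (k := k)
      (by rw [← cyclotomicCoset_add_three]; exact pow_mem_cyclotomicCoset (k + 3)) i j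
  refine ⟨?_, h⟩
  rw [← h]
  unfold interNum sumCount
  simp only [cosetInd_add_three]

/-- `f` is the size of the cosets and `A, B, C, D` are the intersection numbers of the cyclotomic
scheme of class `3`. -/
structure IsInterNumbers (F : Type*) [Field F] [Fintype F] (α : Fˣ) (f A B C D : ℤ) : Prop where
  size : cosetSize (F := F) α = f
  n111 : interNum (F := F) α 1 1 1 = A
  n222 : interNum (F := F) α 2 2 2 = A
  n112 : interNum (F := F) α 1 1 2 = B
  n121 : interNum (F := F) α 1 2 1 = B
  n220 : interNum (F := F) α 2 2 0 = B
  n110 : interNum (F := F) α 1 1 0 = C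
  n221 : interNum (F := F) α 2 2 1 = C
  n122 : interNum (F := F) α 1 2 2 = C
  n120 : interNum (F := F) α 1 2 0 = D
  row₀ : A + B + C = f - 1
  row₁ : B + C + D = f
  quad : A * D + B ^ 2 + C ^ 2 = B * C + C * D + D * B
  card : 3 * f + 1 = Fintype.card F

theorem exists_isInterNumbers (h3 : 3 ∣ Fintype.card F - 1)
    (hα : ∀ u : Fˣ, u ∈ Subgroup.zpowers α) : ∃ f A B C D, IsInterNumbers F α f A B C D := by
  have cl := interNum_comm (F := F) (α := α)
  have cr := interNum_comm_right (F := F) h3 hα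
  have sh := interNum_shift (F := F) (α := α)
  have pe := fun i j k => (interNum_add_three (F := F) (α := α) i j k).2
  have n112 := sh 0 0 1
  have n121 := (cr 1 2 1).trans n112
  have n220 := ((pe 2 2 0).symm.trans (sh 1 1 2)).trans n112
  have n110 := (pe 1 1 0).symm.trans (sh 0 0 2)
  have n221 := (sh 1 1 0).trans n110
  have n122 := ((cl 1 2 2).trans (cr 2 1 2)).trans n221
  have n120 := (cr 1 2 0).trans (cl 1 0 2)
  have n010 := cr 0 1 0
  have n020 := cr 0 2 0
  have n011 := ((cl 0 1 1).trans (cr 1 0 1)).trans n110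
  have n021 := cr 0 2 1
  have n022 := ((cl 0 2 2).trans (cr 2 0 2)).trans n220
  have r0 := interNum_row_sum (F := F) h3 hα 0 0
  have r1 := interNum_row_sum (F := F) h3 hα 0 1
  -- For these indices both terms at 0 vanish, and what remains is exactly `quad`.
  have as := interNum_assoc (F := F) h3 hα 0 0 1 2
  refine ⟨_, interNum (F := F) α 0 0 0, interNum (F := F) α 0 0 1, interNum (F := F) α 0 0 2,
    interNum (F := F) α 0 1 2, rfl, sh 0 0 0, (sh 1 1 1).trans (sh 0 0 0), n112, n121, n220, n110,
    n221, n122, n120, ?_, ?_, ?_, three_mul_cosetSize h3 hα⟩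
  · rw [n010, n020] at r0
    simpa using r0
  · rw [n011, n021] at r1
    simpa using r1
  · rw [sumCount_zero h3 hα, cosetInd_pow h3 hα, cosetInd_pow h3 hα, n112, cl 2 1 2, n122,
      n010, n011, cl 1 0 2, cl 2 0 2, n022] at as
    norm_num at as
    linarith

/-- The numbers of common neighbours in terms of `d = C - B` and `c = 9 A - q + 8`. -/
theorem IsInterNumbers.four_mul_card {f A B C D : ℤ} (h : IsInterNumbers F α f A B C D) :
    4 * (Fintype.card F : ℤ) = (9 * A - Fintype.card F + 8) ^ 2 + 27 * (C - B) ^ 2 := by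
  have h0 := h.row₀
  have h1 := h.row₁
  have hq := h.quad
  rw [← h.card]
  obtain rfl : D = A + 1 := by linarith
  obtain rfl : f = A + B + C + 1 := by linarith
  nlinarith

end Counting
end DezaCyclotomic

namespace DezaCyclotomic

/-! ### Diameter, strong regularity and the Deza property through common neighbours. -/

section Graphs

variable {V : Type*} {G : SimpleGraph V}

theorem ediam_eq_two_iff [Nontrivial V] :
    G.ediam = 2 ↔ (∃ u v, u ≠ v ∧ ¬ G.Adj u v) ∧
      ∀ u v, u ≠ v → ¬ G.Adj u v → (G.commonNeighbors u v).Nonempty := by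
  constructor
  · intro h
    constructor
    · by_contra! hc
      have : G.ediam ≤ 1 := by
        refine SimpleGraph.ediam_le_of_edist_le fun u v => ?_
        rw [SimpleGraph.edist_le_one_iff_adj_or_eq]
        by_cases huv : u = v
        · exact Or.inr huv
        · exact Or.inl (hc u v huv)
      rw [h] at this
      exact absurd this (by decide)
    · intro u v huv hadj
      by_contra hne
      rw [Set.not_nonempty_iff_eq_empty] at hne
      have h1 := SimpleGraph.two_lt_edist_iff.2 ⟨huv, hadj, hne⟩
      exact absurd (h ▸ SimpleGraph.edist_le_ediam (G := G) (u := u) (v := v)) (not_le.2 h1)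
  · rintro ⟨⟨u, v, huv, hadj⟩, hall⟩
    apply le_antisymm
    · refine SimpleGraph.ediam_le_of_edist_le fun x y => ?_
      by_contra! hlt
      obtain ⟨hxy, hnadj, hempty⟩ := SimpleGraph.two_lt_edist_iff.1 hlt
      exact (hall x y hxy hnadj).ne_empty hempty
    · rw [← SimpleGraph.edist_eq_two_iff.2 ⟨huv, hadj, hall u v huv hadj⟩]
      exact SimpleGraph.edist_le_ediam

variable [Fintype V]

theorem isStronglyRegular_iff {k : ℕ} (hk : ∀ v, (G.neighborSet v).ncard = k) :
    IsStronglyRegular G ↔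
      (∃ l, ∀ u v, G.Adj u v → (G.commonNeighbors u v).ncard = l) ∧
      ∃ m, ∀ u v, u ≠ v → ¬ G.Adj u v → (G.commonNeighbors u v).ncard = m := by
  classical
  constructor
  · rintro ⟨n, k', l, m, h⟩
    refine ⟨⟨l, fun u v huv => ?_⟩, ⟨m, fun u v huv hadj => ?_⟩⟩
    · rw [← h.of_adj u v huv, ← Nat.card_coe_set_eq, Nat.card_eq_fintype_card]
    · rw [← h.of_not_adj huv hadj, ← Nat.card_coe_set_eq, Nat.card_eq_fintype_card]
  · rintro ⟨⟨l, hl⟩, ⟨m, hm⟩⟩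
    refine ⟨Fintype.card V, k, l, m, rfl, fun v => ?_, fun u v huv => ?_, fun u v huv hadj => ?_⟩
    · rw [← hk v, ← SimpleGraph.card_neighborSet_eq_degree, ← Nat.card_coe_set_eq,
        Nat.card_eq_fintype_card]
    · rw [← hl u v huv, ← Nat.card_coe_set_eq, Nat.card_eq_fintype_card]
    · rw [← hm u v huv hadj, ← Nat.card_coe_set_eq, Nat.card_eq_fintype_card]

/-- A Deza graph allows at most two values, and b ≠ c already use them up. -/
theorem exists_isDezaWith_iff [Nonempty V] {k m b c : ℕ}
    (hk : ∀ v, (G.neighborSet v).ncard = k)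
    (hcn : ∀ u v, u ≠ v → (G.commonNeighbors u v).ncard = m ∨
      (G.commonNeighbors u v).ncard = b ∨ (G.commonNeighbors u v).ncard = c)
    (hm : ∃ u v, u ≠ v ∧ (G.commonNeighbors u v).ncard = m)
    (hb : ∃ u v, u ≠ v ∧ (G.commonNeighbors u v).ncard = b)
    (hc : ∃ u v, u ≠ v ∧ (G.commonNeighbors u v).ncard = c) (hbc : b ≠ c) :
    (∃ n k b a : ℕ, IsDezaWith G n k b a) ↔ m = b ∨ m = c := by
  have hle : ∀ u v, (G.commonNeighbors u v).ncard ≤ k := fun u v =>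
    hk u ▸ Set.ncard_le_ncard (SimpleGraph.commonNeighbors_subset_neighborSet_left _ _ _)
  have hlt : k < Fintype.card V := by
    obtain ⟨v⟩ := ‹Nonempty V›
    rw [← hk v, ← Nat.card_eq_fintype_card, ← Set.ncard_univ]
    exact Set.ncard_lt_ncard ((Set.ssubset_univ_iff).2 fun h =>
      G.loopless.irrefl v (by have : v ∈ G.neighborSet v := h ▸ Set.mem_univ v; exact this))
  constructor
  · rintro ⟨n, k', b', a', h⟩
    obtain ⟨u, v, huv, rfl⟩ := hm
    obtain ⟨x, y, hxy, rfl⟩ := hb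
    obtain ⟨z, w, hzw, rfl⟩ := hc
    have h1 := h.commonNeighbors u v huv
    have h2 := h.commonNeighbors x y hxy
    have h3 := h.commonNeighbors z w hzw
    omega
  · intro h
    have hcn' : ∀ u v, u ≠ v → (G.commonNeighbors u v).ncard = b ∨
        (G.commonNeighbors u v).ncard = c := by
      intro u v huv
      have := hcn u v huv
      omega
    rcases le_total b c with hle' | hle'
    · exact ⟨_, k, c, b, hle', by obtain ⟨u, v, -, rfl⟩ := hc; exact hle u v, hlt, rfl, hk, hcn',
        hb, hc⟩
    · exact ⟨_, k, b, c, hle', by obtain ⟨u, v, -, rfl⟩ := hb; exact hle u v, hlt, rfl, hk,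
        fun u v huv => (hcn' u v huv).symm, hc, hb⟩

/-- A regular graph in which adjacent vertices have `m` common neighbours and distinct nonadjacent
ones have `b` or `c`. -/
theorem isStrictlyDeza_iff_of_adj [Nontrivial V] {k m b c : ℕ}
    (hk : ∀ v, (G.neighborSet v).ncard = k)
    (hadj : ∀ u v, G.Adj u v → (G.commonNeighbors u v).ncard = m)
    (hnadj : ∀ u v, u ≠ v → ¬ G.Adj u v → (G.commonNeighbors u v).ncard = b ∨
      (G.commonNeighbors u v).ncard = c)
    (hm : ∃ u v, G.Adj u v)
    (hb : ∃ u v, u ≠ v ∧ ¬ G.Adj u v ∧ (G.commonNeighbors u v).ncard = b)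
    (hc : ∃ u v, u ≠ v ∧ ¬ G.Adj u v ∧ (G.commonNeighbors u v).ncard = c) :
    IsStrictlyDeza G ↔ b ≠ c ∧ (m = b ∨ m = c) ∧ 0 < b ∧ 0 < c := by
  have hsrg : IsStronglyRegular G ↔ b = c := by
    rw [isStronglyRegular_iff hk]
    constructor
    · rintro ⟨-, l, hl⟩
      obtain ⟨u, v, h1, h2, rfl⟩ := hb
      obtain ⟨x, y, h3, h4, rfl⟩ := hc
      rw [hl u v h1 h2, hl x y h3 h4]
    · rintro rfl
      exact ⟨⟨m, hadj⟩, ⟨b, fun u v h1 h2 => (hnadj u v h1 h2).elim id id⟩⟩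
  have hdiam : G.ediam = 2 ↔ 0 < b ∧ 0 < c := by
    rw [ediam_eq_two_iff]
    constructor
    · rintro ⟨-, h⟩
      obtain ⟨u, v, h1, h2, rfl⟩ := hb
      obtain ⟨x, y, h3, h4, rfl⟩ := hc
      exact ⟨(Set.ncard_pos).2 (h u v h1 h2), (Set.ncard_pos).2 (h x y h3 h4)⟩
    · rintro ⟨h1, h2⟩
      refine ⟨?_, fun u v h3 h4 => ?_⟩
      · obtain ⟨u, v, h3, h4, -⟩ := hb
        exact ⟨u, v, h3, h4⟩
      · rw [← Set.ncard_pos]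
        rcases hnadj u v h3 h4 with h | h <;> rw [h] <;> assumption
  unfold IsStrictlyDeza
  rw [hsrg, hdiam]
  by_cases hbc : b = c
  · simp [hbc]
  · rw [exists_isDezaWith_iff (m := m) (b := b) (c := c) hk ?_ ?_ ?_ ?_ hbc]
    · tauto
    · intro u v huv
      by_cases h : G.Adj u v
      · exact Or.inl (hadj u v h)
      · exact Or.inr (hnadj u v huv h)
    · obtain ⟨u, v, h⟩ := hm
      exact ⟨u, v, h.ne, hadj u v h⟩
    · obtain ⟨u, v, h1, -, h2⟩ := hb
      exact ⟨u, v, h1, h2⟩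
    · obtain ⟨u, v, h1, -, h2⟩ := hc
      exact ⟨u, v, h1, h2⟩

/-- A regular graph in which distinct nonadjacent vertices have `m > 0` common neighbours and
adjacent ones have `b` or `c`. -/
theorem isStrictlyDeza_iff_of_not_adj [Nontrivial V] {k m b c : ℕ}
    (hk : ∀ v, (G.neighborSet v).ncard = k)
    (hnadj : ∀ u v, u ≠ v → ¬ G.Adj u v → (G.commonNeighbors u v).ncard = m)
    (hadj : ∀ u v, G.Adj u v → (G.commonNeighbors u v).ncard = b ∨
      (G.commonNeighbors u v).ncard = c)
    (hm : ∃ u v, u ≠ v ∧ ¬ G.Adj u v) (hm0 : 0 < m)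
    (hb : ∃ u v, G.Adj u v ∧ (G.commonNeighbors u v).ncard = b)
    (hc : ∃ u v, G.Adj u v ∧ (G.commonNeighbors u v).ncard = c) :
    IsStrictlyDeza G ↔ b ≠ c ∧ (m = b ∨ m = c) := by
  have hsrg : IsStronglyRegular G ↔ b = c := by
    rw [isStronglyRegular_iff hk]
    constructor
    · rintro ⟨⟨l, hl⟩, -⟩
      obtain ⟨u, v, h1, rfl⟩ := hb
      obtain ⟨x, y, h3, rfl⟩ := hc
      rw [hl u v h1, hl x y h3]
    · rintro rfl
      exact ⟨⟨b, fun u v h1 => (hadj u v h1).elim id id⟩, ⟨m, hnadj⟩⟩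
  have hdiam : G.ediam = 2 :=
    ediam_eq_two_iff.2 ⟨hm, fun u v h3 h4 => (Set.ncard_pos (Set.toFinite _)).1
    (by rwa [hnadj u v h3 h4])⟩
  unfold IsStrictlyDeza
  rw [hsrg]
  by_cases hbc : b = c
  · simp [hbc]
  · rw [exists_isDezaWith_iff (m := m) (b := b) (c := c) hk ?_ ?_ ?_ ?_ hbc]
    · tauto
    · intro u v huv
      by_cases h : G.Adj u v
      · exact Or.inr (hadj u v h)
      · exact Or.inl (hnadj u v huv h)
    · obtain ⟨u, v, h1, h2⟩ := hm
      exact ⟨u, v, h1, hnadj u v h1 h2⟩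
    · obtain ⟨u, v, h1, h2⟩ := hb
      exact ⟨u, v, h1.ne, h2⟩
    · obtain ⟨u, v, h1, h2⟩ := hc
      exact ⟨u, v, h1.ne, h2⟩

end Graphs

/-! ### The graphs of the scheme as Cayley graphs. -/

section Cayley

variable {F : Type*} [Field F] {α : Fˣ}

theorem schemeGraph_adj_iff (hα : ∀ u : Fˣ, u ∈ Subgroup.zpowers α) {J : Set ℕ} (hJ : 0 ∉ J)
    (x y : F) : (schemeGraph α hα J).Adj x y ↔ ∃ j ∈ J, x - y ∈ cyclotomicCoset α 3 j := by
  constructor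
  · rintro ⟨-, j, hj, h⟩
    obtain ⟨i, rfl⟩ := Nat.exists_eq_succ_of_ne_zero (show j ≠ 0 by rintro rfl; exact hJ hj)
    exact ⟨i + 1, hj, h⟩
  · rintro ⟨j, hj, h⟩
    refine ⟨?_, j, hj, ?_⟩
    · rintro rfl
      rw [sub_self] at h
      exact zero_notMem_cyclotomicCoset j h
    · obtain ⟨i, rfl⟩ := Nat.exists_eq_succ_of_ne_zero (show j ≠ 0 by rintro rfl; exact hJ hj)
      exact h

theorem isCayleyGraph_Gam (hα : ∀ u : Fˣ, u ∈ Subgroup.zpowers α) {i : ℕ} (hi : i ≠ 0) :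
    IsCayleyGraph (Gam α hα i) (cyclotomicCoset α 3 i) := by
  refine ⟨zero_notMem_cyclotomicCoset i, fun x hx => neg_mem_cyclotomicCoset_three hα hx,
    fun x y => ?_⟩
  rw [Gam, schemeGraph_adj_iff hα (by simpa using hi.symm)]
  simp

/-- Multiplication by a unit as an isomorphism of Cayley graphs. -/
theorem nonempty_iso_of_isCayleyGraph {G H : SimpleGraph F} {S T : Set F}
    (hG : IsCayleyGraph G S) (hH : IsCayleyGraph H T) (u : Fˣ)
    (hST : ∀ x, (u : F) * x ∈ T ↔ x ∈ S) : Nonempty (G ≃g H) := by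
  refine ⟨⟨Equiv.mulLeft₀ (u : F) u.ne_zero, ?_⟩⟩
  intro x y
  rw [hG.2.2, hH.2.2, ← hST]
  simp [mul_sub]

/-- The span of a coset is stable under S, so it contains a whole coset as soon as it contains one
element of it. -/
theorem mul_mem_closure_cyclotomicCoset {i : ℕ} {s x : F} (hs : s ∈ cyclotomicCoset α 3 0)
    (hx : x ∈ AddSubgroup.closure (cyclotomicCoset α 3 i)) :
    s * x ∈ AddSubgroup.closure (cyclotomicCoset α 3 i) := by
  induction hx using AddSubgroup.closure_induction with
  | mem x hx =>
    exact AddSubgroup.subset_closure ((mul_mem_cyclotomicCoset_iff (i := i) hs).2 hx)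
  | zero => simp
  | add x y _ _ hx hy => rw [mul_add]; exact add_mem hx hy
  | neg x _ hx => rw [mul_neg]; exact neg_mem hx

theorem ncard_neighborSet {G : SimpleGraph F} {S : Set F} (hG : IsCayleyGraph G S) (v : F) :
    (G.neighborSet v).ncard = S.ncard := by
  have : G.neighborSet v = (fun x => v - x) '' S := by
    ext x
    rw [SimpleGraph.mem_neighborSet, hG.2.2]
    exact ⟨fun h => ⟨v - x, h, sub_sub_cancel v x⟩, by rintro ⟨y, hy, rfl⟩; simpa using hy⟩
  rw [this, Set.ncard_image_of_injective _ sub_right_injective]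

variable [Fintype F]

theorem compl_diff_cyclotomicCoset_iff (h3 : 3 ∣ Fintype.card F - 1)
    (hα : ∀ u : Fˣ, u ∈ Subgroup.zpowers α) {i : ℕ} (hi : i ∈ ({1, 2, 3} : Set ℕ)) (x : F) :
    x ∈ ({0}ᶜ : Set F) \ cyclotomicCoset α 3 i ↔
      ∃ j ∈ ({1, 2, 3} : Set ℕ) \ {i}, x ∈ cyclotomicCoset α 3 j := by
  by_cases hx : x = 0
  · subst hx
    simp [zero_notMem_cyclotomicCoset]
  obtain ⟨n, rfl⟩ := exists_zpow_eq hα hx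
  simp only [Set.mem_sdiff, Set.mem_compl_iff, Set.mem_singleton_iff, hx, not_false_eq_true,
    true_and, zpow_mem_cyclotomicCoset_iff h3 hα]
  constructor
  · intro h
    have h2 : n % 3 = 0 ∨ n % 3 = 1 ∨ n % 3 = 2 := by omega
    rcases h2 with h2 | h2 | h2
    · exact ⟨3, ⟨by simp, by rintro rfl; omega⟩, by omega⟩
    · exact ⟨1, ⟨by simp, by rintro rfl; omega⟩, by omega⟩
    · exact ⟨2, ⟨by simp, by rintro rfl; omega⟩, by omega⟩
  · rintro ⟨j, ⟨hj, hji⟩, h⟩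
    simp only [Set.mem_insert_iff, Set.mem_singleton_iff] at hi hj
    omega

theorem isCayleyGraph_GamBar (h3 : 3 ∣ Fintype.card F - 1)
    (hα : ∀ u : Fˣ, u ∈ Subgroup.zpowers α) {i : ℕ} (hi : i ∈ ({1, 2, 3} : Set ℕ)) :
    IsCayleyGraph (GamBar α hα i) (({0}ᶜ : Set F) \ cyclotomicCoset α 3 i) := by
  refine ⟨by simp, ?_, ?_⟩
  · rintro x ⟨h1, h2⟩
    exact ⟨by simpa using h1, fun h => h2 (by simpa using neg_mem_cyclotomicCoset_three hα h)⟩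
  · intro x y
    rw [GamBar, schemeGraph_adj_iff hα (by simp), compl_diff_cyclotomicCoset_iff h3 hα hi]

theorem zpow_sub_mul_mem_iff (h3 : 3 ∣ Fintype.card F - 1)
    (hα : ∀ u : Fˣ, u ∈ Subgroup.zpowers α) (i j : ℕ) (x : F) :
    ((α ^ ((j : ℤ) - i) : Fˣ) : F) * x ∈ cyclotomicCoset α 3 j ↔ x ∈ cyclotomicCoset α 3 i := by
  by_cases hx : x = 0
  · subst hx
    simp [zero_notMem_cyclotomicCoset]
  obtain ⟨n, rfl⟩ := exists_zpow_eq hα hx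
  rw [← Units.val_mul, ← zpow_add, zpow_mem_cyclotomicCoset_iff h3 hα,
    zpow_mem_cyclotomicCoset_iff h3 hα]
  omega

theorem nonempty_Gam_iso (h3 : 3 ∣ Fintype.card F - 1)
    (hα : ∀ u : Fˣ, u ∈ Subgroup.zpowers α) {i j : ℕ} (hi : i ≠ 0) (hj : j ≠ 0) :
    Nonempty (Gam α hα i ≃g Gam α hα j) :=
  nonempty_iso_of_isCayleyGraph (isCayleyGraph_Gam hα hi) (isCayleyGraph_Gam hα hj)
    (α ^ ((j : ℤ) - i)) (zpow_sub_mul_mem_iff h3 hα i j)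

theorem nonempty_GamBar_iso (h3 : 3 ∣ Fintype.card F - 1)
    (hα : ∀ u : Fˣ, u ∈ Subgroup.zpowers α) {i j : ℕ} (hi : i ∈ ({1, 2, 3} : Set ℕ))
    (hj : j ∈ ({1, 2, 3} : Set ℕ)) :
    Nonempty (GamBar α hα i ≃g GamBar α hα j) := by
  refine nonempty_iso_of_isCayleyGraph (isCayleyGraph_GamBar h3 hα hi)
    (isCayleyGraph_GamBar h3 hα hj) (α ^ ((j : ℤ) - i)) fun x => ?_
  simp only [Set.mem_sdiff, zpow_sub_mul_mem_iff h3 hα i j x, Set.mem_compl_iff,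
    Set.mem_singleton_iff, mul_eq_zero, (α ^ ((j : ℤ) - i)).ne_zero, false_or]

/-! ### Generation -/

theorem ncard_cyclotomicCoset (i : ℕ) :
    ((cyclotomicCoset α 3 i : Set F).ncard : ℤ) = cosetSize (F := F) α := by
  classical
  rw [← sum_cosetInd i, Set.ncard_eq_toFinset_card']
  simp only [cosetInd, Finset.sum_boole, Set.toFinset_card, Fintype.card_subtype]

theorem disjoint_cyclotomicCoset (h3 : 3 ∣ Fintype.card F - 1)
    (hα : ∀ u : Fˣ, u ∈ Subgroup.zpowers α) {i j : ℕ} (hij : ¬ (3 : ℤ) ∣ (i : ℤ) - j) :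
    Disjoint (cyclotomicCoset α 3 i : Set F) (cyclotomicCoset α 3 j) := by
  rw [Set.disjoint_left]
  intro x hx hx'
  obtain ⟨n, rfl⟩ := exists_zpow_eq hα (x := x)
    (by rintro rfl; exact zero_notMem_cyclotomicCoset _ hx)
  rw [zpow_mem_cyclotomicCoset_iff h3 hα] at hx hx'
  omega

theorem eq_top_of_cyclotomicCoset_subset (h3 : 3 ∣ Fintype.card F - 1)
    (hα : ∀ u : Fˣ, u ∈ Subgroup.zpowers α) {i j : ℕ} (hij : ¬ (3 : ℤ) ∣ (i : ℤ) - j)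
    {H : AddSubgroup F} (hi : cyclotomicCoset α 3 i ⊆ (H : Set F))
    (hj : cyclotomicCoset α 3 j ⊆ (H : Set F)) : H = ⊤ := by
  have hsub : insert 0 (cyclotomicCoset α 3 i ∪ cyclotomicCoset α 3 j) ⊆ (H : Set F) :=
    Set.insert_subset H.zero_mem (Set.union_subset hi hj)
  have hle := Set.ncard_le_ncard hsub
  rw [Set.ncard_insert_of_notMem (by simp [zero_notMem_cyclotomicCoset]),
    Set.ncard_union_eq (disjoint_cyclotomicCoset h3 hα hij)] at hle
  have hi' := ncard_cyclotomicCoset (F := F) (α := α) i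
  have hj' := ncard_cyclotomicCoset (F := F) (α := α) j
  have hq := three_mul_cosetSize (F := F) h3 hα
  have hf := cosetSize_pos (F := F) h3 hα
  have hcard : Nat.card H = (H : Set F).ncard := Nat.card_coe_set_eq _
  have hdvd := AddSubgroup.card_addSubgroup_dvd_card H
  rw [Nat.card_eq_fintype_card (α := F), hcard] at hdvd
  rw [← AddSubgroup.card_eq_iff_eq_top, hcard, Nat.card_eq_fintype_card]
  obtain ⟨c, hc⟩ := hdvd
  -- H has at least 2f + 1 of the 3f + 1 elements, more than half, so its index is 1.
  have : c = 1 := by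
    have h1 : c < 2 := by
      by_contra! h2
      have : (H : Set F).ncard * 2 ≤ (H : Set F).ncard * c := Nat.mul_le_mul_left _ h2
      omega
    have : c ≠ 0 := by
      rintro rfl
      omega
    omega
  rw [hc, this, mul_one]

theorem closure_compl_diff_cyclotomicCoset (h3 : 3 ∣ Fintype.card F - 1)
    (hα : ∀ u : Fˣ, u ∈ Subgroup.zpowers α) {i : ℕ} (hi : i ∈ ({1, 2, 3} : Set ℕ)) :
    AddSubgroup.closure (({0}ᶜ : Set F) \ cyclotomicCoset α 3 i) = ⊤ := by
  have hsub : ∀ j ∈ ({1, 2, 3} : Set ℕ) \ {i}, cyclotomicCoset α 3 j ⊆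
      ((AddSubgroup.closure (({0}ᶜ : Set F) \ cyclotomicCoset α 3 i) : AddSubgroup F) : Set F) :=
    fun j hj x hx => AddSubgroup.subset_closure
      ((compl_diff_cyclotomicCoset_iff h3 hα hi x).2 ⟨j, hj, hx⟩)
  rcases hi with rfl | rfl | rfl
  · exact eq_top_of_cyclotomicCoset_subset h3 hα (i := 2) (j := 3) (by norm_num)
      (hsub 2 (by simp)) (hsub 3 (by simp))
  · exact eq_top_of_cyclotomicCoset_subset h3 hα (i := 1) (j := 3) (by norm_num)
      (hsub 1 (by simp)) (hsub 3 (by simp))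
  · exact eq_top_of_cyclotomicCoset_subset h3 hα (i := 1) (j := 2) (by norm_num)
      (hsub 1 (by simp)) (hsub 2 (by simp))

/-- Either the span meets another coset, hence contains two cosets and is everything, or the coset
together with 0 is a subgroup. In the latter case f + 1 divides 3f + 1, so f = 1 and q = 4. -/
theorem closure_cyclotomicCoset (h3 : 3 ∣ Fintype.card F - 1)
    (hα : ∀ u : Fˣ, u ∈ Subgroup.zpowers α) (h4 : Fintype.card F ≠ 4) (i : ℕ) :
    AddSubgroup.closure (cyclotomicCoset α 3 i : Set F) = ⊤ := by
  set H := AddSubgroup.closure (cyclotomicCoset α 3 i : Set F) with hH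
  by_cases hx : ∃ x ∈ H, x ≠ 0 ∧ x ∉ cyclotomicCoset α 3 i
  · obtain ⟨x, hxH, hx0, hxi⟩ := hx
    obtain ⟨n, rfl⟩ := exists_zpow_eq hα hx0
    obtain ⟨j, hj⟩ : ∃ j : ℕ, (3 : ℤ) ∣ n - j := ⟨(n % 3).toNat, by omega⟩
    rw [zpow_mem_cyclotomicCoset_iff h3 hα] at hxi
    refine eq_top_of_cyclotomicCoset_subset h3 hα (i := i) (j := j) (by omega)
      AddSubgroup.subset_closure ?_
    intro y hy
    obtain ⟨m, rfl⟩ := exists_zpow_eq hα (x := y)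
      (by rintro rfl; exact zero_notMem_cyclotomicCoset _ hy)
    rw [zpow_mem_cyclotomicCoset_iff h3 hα] at hy
    have := mul_mem_closure_cyclotomicCoset (s := ((α ^ (m - n) : Fˣ) : F))
      ((zpow_mem_cyclotomicCoset_iff h3 hα _ _).2 (by push_cast; omega)) hxH
    rwa [← Units.val_mul, ← zpow_add, sub_add_cancel] at this
  · exfalso
    push Not at hx
    have hHeq : (H : Set F) = insert 0 (cyclotomicCoset α 3 i) := by
      ext x
      constructor
      · intro h
        by_cases hx0 : x = 0
        · exact Or.inl hx0
        · exact Or.inr (hx x h hx0)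
      · rintro (rfl | h)
        · exact H.zero_mem
        · exact AddSubgroup.subset_closure h
    have hcard : Nat.card H = (H : Set F).ncard := Nat.card_coe_set_eq _
    have hdvd := AddSubgroup.card_addSubgroup_dvd_card H
    rw [hcard, hHeq, Set.ncard_insert_of_notMem (zero_notMem_cyclotomicCoset i),
      Nat.card_eq_fintype_card] at hdvd
    have hq := three_mul_cosetSize (F := F) h3 hα
    have hf := cosetSize_pos (F := F) h3 hα
    rw [← ncard_cyclotomicCoset i] at hq hf
    generalize (cyclotomicCoset α 3 i : Set F).ncard = f at *
    have h2 : f + 1 ∣ 2 := by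
      -- 3(f + 1) = q + 2.
      have h5 : f + 1 ∣ Fintype.card F + 2 := ⟨3, by omega⟩
      exact (Nat.dvd_add_right hdvd).1 h5
    have := Nat.le_of_dvd two_pos h2
    omega

/-! ### Common neighbours -/

theorem ncard_commonNeighbors {G : SimpleGraph F} {S : Set F} (hG : IsCayleyGraph G S)
    {t : F → ℤ} (h1 : ∀ x ∈ S, t x = 1) (h0 : ∀ x ∉ S, t x = 0) (u v : F) :
    ((G.commonNeighbors u v).ncard : ℤ) = ∑ x, t x * t (u - v - x) := by
  classical
  have hmem : ∀ x, u - x ∈ G.commonNeighbors u v ↔ x ∈ S ∧ u - v - x ∈ S := by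
    intro x
    rw [SimpleGraph.mem_commonNeighbors, hG.2.2, hG.2.2, sub_sub_cancel]
    refine and_congr_right fun _ => ⟨fun h => ?_, fun h => ?_⟩
    · have := hG.2.1 _ h
      rwa [show -(v - (u - x)) = u - v - x by ring] at this
    · have := hG.2.1 _ h
      rwa [show -(u - v - x) = v - (u - x) by ring] at this
  have himg : G.commonNeighbors u v = (fun x => u - x) '' {x | x ∈ S ∧ u - v - x ∈ S} := by
    ext x
    constructor
    · intro h
      exact ⟨u - x, (hmem _).1 (by rwa [sub_sub_cancel]), sub_sub_cancel u x⟩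
    · rintro ⟨y, hy, rfl⟩
      exact (hmem y).2 hy
  rw [himg, Set.ncard_image_of_injective _ sub_right_injective, Set.ncard_eq_toFinset_card',
    Set.toFinset_ofPred, Finset.natCast_card_filter]
  refine Finset.sum_congr rfl fun x _ => ?_
  by_cases hx : x ∈ S <;> by_cases hy : u - v - x ∈ S <;> simp [hx, hy, h0, h1]

theorem ncard_commonNeighbors_Gam (hα : ∀ u : Fˣ, u ∈ Subgroup.zpowers α) {i : ℕ} (hi : i ≠ 0)
    (u v : F) : (((Gam α hα i).commonNeighbors u v).ncard : ℤ) = sumCount α i i (u - v) :=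
  ncard_commonNeighbors (isCayleyGraph_Gam hα hi) (fun _ h => cosetInd_of_mem h)
    (fun _ h => cosetInd_of_notMem h) u v

theorem ncard_commonNeighbors_GamBar (h3 : 3 ∣ Fintype.card F - 1)
    (hα : ∀ u : Fˣ, u ∈ Subgroup.zpowers α) (u v : F) :
    (((GamBar α hα 3).commonNeighbors u v).ncard : ℤ) =
      sumCount α 1 1 (u - v) + 2 * sumCount α 1 2 (u - v) + sumCount α 2 2 (u - v) := by
  rw [ncard_commonNeighbors (isCayleyGraph_GamBar h3 hα (by simp))
    (t := fun x => cosetInd α 1 x + cosetInd α 2 x), two_mul]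
  · nth_rewrite 2 [sumCount_comm]
    simp only [sumCount, ← Finset.sum_add_distrib]
    exact Finset.sum_congr rfl fun x _ => by ring
  · rintro x ⟨hx0, hx⟩
    have := cosetInd_sum h3 hα hx0
    rw [← cosetInd_add_three, zero_add, cosetInd_of_notMem hx] at this
    linarith
  · intro x hx
    by_cases hx0 : x = 0
    · simp [hx0, cosetInd_zero]
    · have hx3 : x ∈ cyclotomicCoset α 3 3 := by
        by_contra h
        exact hx ⟨hx0, h⟩
      have := cosetInd_sum h3 hα hx0
      rw [← cosetInd_add_three, zero_add, cosetInd_of_mem hx3] at this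
      linarith

theorem exists_mem_cyclotomicCoset (h3 : 3 ∣ Fintype.card F - 1)
    (hα : ∀ u : Fˣ, u ∈ Subgroup.zpowers α) {x : F} (hx : x ≠ 0) :
    x ∈ cyclotomicCoset α 3 0 ∨ x ∈ cyclotomicCoset α 3 1 ∨ x ∈ cyclotomicCoset α 3 2 := by
  obtain ⟨n, rfl⟩ := exists_zpow_eq hα hx
  simp only [zpow_mem_cyclotomicCoset_iff h3 hα]
  omega

variable {f A B C D : ℤ}

theorem isStrictlyDeza_Gam_iff (h3 : 3 ∣ Fintype.card F - 1)
    (hα : ∀ u : Fˣ, u ∈ Subgroup.zpowers α) (h : IsInterNumbers F α f A B C D) :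
    IsStrictlyDeza (Gam α hα 1) ↔ B ≠ C ∧ (A = B ∨ A = C) ∧ 0 < B ∧ 0 < C := by
  have hcay := isCayleyGraph_Gam (F := F) hα one_ne_zero
  have hcn := ncard_commonNeighbors_Gam (F := F) hα one_ne_zero
  have cn : ∀ k u v, u - v ∈ cyclotomicCoset α 3 k →
      (((Gam α hα 1).commonNeighbors u v).ncard : ℤ) = interNum (F := F) α 1 1 k :=
    fun k u v huv => by rw [hcn, sumCount_of_mem huv]
  have cn0 : ∀ k, (((Gam α hα 1).commonNeighbors ((α ^ k : Fˣ) : F) 0).ncard : ℤ) =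
      interNum (F := F) α 1 1 k :=
    fun k => cn k _ _ (by rw [sub_zero]; exact pow_mem_cyclotomicCoset k)
  have hA : 0 ≤ A := by rw [← h.n111, ← cn0]; positivity
  have hB : 0 ≤ B := by rw [← h.n112, ← cn0]; positivity
  have hC : 0 ≤ C := by rw [← h.n110, ← cn0]; positivity
  lift A to ℕ using hA
  lift B to ℕ using hB
  lift C to ℕ using hC
  have adj0 : ∀ k : ℕ, (Gam α hα 1).Adj ((α ^ k : Fˣ) : F) 0 ↔ (3 : ℤ) ∣ (k : ℤ) - 1 := by
    intro k
    rw [hcay.2.2, sub_zero, ← zpow_natCast, zpow_mem_cyclotomicCoset_iff h3 hα]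
    rfl
  rw [isStrictlyDeza_iff_of_adj (G := Gam α hα 1) (m := A) (b := B) (c := C)
    (ncard_neighborSet hcay)]
  · norm_cast
  · intro u v huv
    rw [hcay.2.2] at huv
    exact_mod_cast (cn 1 u v huv).trans h.n111
  · intro u v huv hadj
    rw [hcay.2.2] at hadj
    rcases exists_mem_cyclotomicCoset h3 hα (sub_ne_zero.2 huv) with h0 | h0 | h0
    · exact Or.inr (by exact_mod_cast (cn 0 u v h0).trans h.n110)
    · exact absurd h0 hadj
    · exact Or.inl (by exact_mod_cast (cn 2 u v h0).trans h.n112)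
  · exact ⟨_, _, (adj0 1).2 (by norm_num)⟩
  · exact ⟨_, _, (α ^ 2).ne_zero, by rw [adj0]; norm_num, by exact_mod_cast (cn0 2).trans h.n112⟩
  · exact ⟨_, _, (α ^ 0).ne_zero, by rw [adj0]; norm_num, by exact_mod_cast (cn0 0).trans h.n110⟩

/-- The diameter imposes no condition here: nonadjacent vertices have f + 1 + A > 0 common
neighbours. -/
theorem isStrictlyDeza_GamBar_iff (h3 : 3 ∣ Fintype.card F - 1)
    (hα : ∀ u : Fˣ, u ∈ Subgroup.zpowers α) (h : IsInterNumbers F α f A B C D) :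
    IsStrictlyDeza (GamBar α hα 3) ↔ B ≠ C ∧ (A + 2 = B ∨ A + 2 = C) := by
  have hcay := isCayleyGraph_GamBar (F := F) h3 hα (i := 3) (by simp)
  have hcn := ncard_commonNeighbors_GamBar (F := F) h3 hα
  have r0 := h.row₀
  have r1 := h.row₁
  have cn : ∀ k u v, u - v ∈ cyclotomicCoset α 3 k →
      (((GamBar α hα 3).commonNeighbors u v).ncard : ℤ) = interNum (F := F) α 1 1 k +
        2 * interNum (F := F) α 1 2 k + interNum (F := F) α 2 2 k :=
    fun k u v huv => by rw [hcn, sumCount_of_mem huv, sumCount_of_mem huv, sumCount_of_mem huv]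
  have c0 : ∀ u v, u - v ∈ cyclotomicCoset α 3 0 →
      (((GamBar α hα 3).commonNeighbors u v).ncard : ℤ) = f + 1 + A := fun u v huv => by
    rw [cn 0 u v huv, h.n110, h.n120, h.n220]
    linarith
  have c1 : ∀ u v, u - v ∈ cyclotomicCoset α 3 1 →
      (((GamBar α hα 3).commonNeighbors u v).ncard : ℤ) = f - 1 + B := fun u v huv => by
    rw [cn 1 u v huv, h.n111, h.n121, h.n221]
    linarith
  have c2 : ∀ u v, u - v ∈ cyclotomicCoset α 3 2 →
      (((GamBar α hα 3).commonNeighbors u v).ncard : ℤ) = f - 1 + C := fun u v huv => by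
    rw [cn 2 u v huv, h.n112, h.n122, h.n222]
    linarith
  have hmem : ∀ k, ((α ^ k : Fˣ) : F) - 0 ∈ cyclotomicCoset α 3 k := fun k => by
    rw [sub_zero]
    exact pow_mem_cyclotomicCoset k
  obtain ⟨m, hm⟩ := Int.eq_ofNat_of_zero_le (a := f + 1 + A)
    (by rw [← c0 _ _ (hmem 0)]; positivity)
  obtain ⟨b, hb⟩ := Int.eq_ofNat_of_zero_le (a := f - 1 + B)
    (by rw [← c1 _ _ (hmem 1)]; positivity)
  obtain ⟨c, hc⟩ := Int.eq_ofNat_of_zero_le (a := f - 1 + C)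
    (by rw [← c2 _ _ (hmem 2)]; positivity)
  have hA : 0 ≤ A := by
    have := ncard_commonNeighbors_Gam (F := F) hα one_ne_zero ((α ^ 1 : Fˣ) : F) 0
    rw [sumCount_of_mem (hmem 1), h.n111] at this
    rw [← this]
    positivity
  have hf := cosetSize_pos (F := F) h3 hα
  rw [h.size] at hf
  have adj0 : ∀ k : ℕ, (GamBar α hα 3).Adj ((α ^ k : Fˣ) : F) 0 ↔ ¬ (3 : ℤ) ∣ (k : ℤ) - 3 := by
    intro k
    rw [hcay.2.2, sub_zero, ← zpow_natCast, Set.mem_sdiff, zpow_mem_cyclotomicCoset_iff h3 hα]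
    simp
  have hc30 : (cyclotomicCoset α 3 3 : Set F) = cyclotomicCoset α 3 0 :=
    cyclotomicCoset_add_three 0
  rw [isStrictlyDeza_iff_of_not_adj (G := GamBar α hα 3) (m := m) (b := b) (c := c)
    (ncard_neighborSet hcay)]
  · omega
  · intro u v huv hadj
    rw [hcay.2.2, hc30] at hadj
    have h0 : u - v ∈ cyclotomicCoset α 3 0 := by
      by_contra h0
      exact hadj ⟨sub_ne_zero.2 huv, h0⟩
    exact_mod_cast (c0 u v h0).trans hm
  · intro u v hadj
    rw [hcay.2.2, hc30] at hadj
    rcases exists_mem_cyclotomicCoset h3 hα hadj.1 with h0 | h0 | h0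
    · exact absurd h0 hadj.2
    · exact Or.inl (by exact_mod_cast (c1 u v h0).trans hb)
    · exact Or.inr (by exact_mod_cast (c2 u v h0).trans hc)
  · exact ⟨_, _, (α ^ 0).ne_zero, by rw [adj0]; norm_num⟩
  · omega
  · exact ⟨_, _, (adj0 1).2 (by norm_num), by exact_mod_cast (c1 _ _ (hmem 1)).trans hb⟩
  · exact ⟨_, _, (adj0 2).2 (by norm_num), by exact_mod_cast (c2 _ _ (hmem 2)).trans hc⟩

end Cayley
end DezaCyclotomic

namespace DezaCyclotomic

/-! ### Prime powers of the form x² + 3 or x² + 12: imaginary parts of powers in ℤ[√-3]. -/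

section Diophantine

open Zsqrtd

theorem Zsqrtd_neg_three_pow_two (a b : ℤ) :
    (⟨a, b⟩ : ℤ√(-3)) ^ 2 = ⟨a ^ 2 - 3 * b ^ 2, 2 * a * b⟩ := by
  ext <;> simp [pow_two] <;> ring

theorem Zsqrtd_neg_three_pow_three (a b : ℤ) :
    (⟨a, b⟩ : ℤ√(-3)) ^ 3 = ⟨a ^ 3 - 9 * a * b ^ 2, b * (3 * a ^ 2 - 3 * b ^ 2)⟩ := by
  rw [pow_succ, Zsqrtd_neg_three_pow_two]
  ext <;> simp <;> ring

theorem Zsqrtd_neg_three_pow_four (a b : ℤ) :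
    (⟨a, b⟩ : ℤ√(-3)) ^ 4 =
      ⟨a ^ 4 - 18 * a ^ 2 * b ^ 2 + 9 * b ^ 4, 4 * a * b * (a ^ 2 - 3 * b ^ 2)⟩ := by
  rw [show 4 = 2 * 2 from rfl, pow_mul, Zsqrtd_neg_three_pow_two, Zsqrtd_neg_three_pow_two]
  ext <;> simp <;> ring

theorem Zsqrtd_neg_three_pow_five_im (a b : ℤ) :
    ((⟨a, b⟩ : ℤ√(-3)) ^ 5).im = b * (5 * a ^ 4 - 30 * a ^ 2 * b ^ 2 + 9 * b ^ 4) := by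
  rw [pow_succ, Zsqrtd_neg_three_pow_four]
  simp
  ring

theorem Zsqrtd_neg_three_pow_six (a b : ℤ) :
    (⟨a, b⟩ : ℤ√(-3)) ^ 6 =
      ⟨a ^ 6 - 45 * a ^ 4 * b ^ 2 + 135 * a ^ 2 * b ^ 4 - 27 * b ^ 6,
        6 * a * b * (a ^ 4 - 10 * a ^ 2 * b ^ 2 + 9 * b ^ 4)⟩ := by
  rw [show 6 = 3 * 2 from rfl, pow_mul, Zsqrtd_neg_three_pow_three, Zsqrtd_neg_three_pow_two]
  ext <;> simp <;> ring

theorem Zsqrtd_neg_three_pow_seven_im (a b : ℤ) :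
    ((⟨a, b⟩ : ℤ√(-3)) ^ 7).im =
      b * (7 * a ^ 6 - 105 * a ^ 4 * b ^ 2 + 189 * a ^ 2 * b ^ 4 - 27 * b ^ 6) := by
  rw [pow_succ, Zsqrtd_neg_three_pow_six]
  simp
  ring

theorem exists_sq_eq_one_add_three_mul {a : ℤ} (ha : ¬ 3 ∣ a) : ∃ t, a ^ 2 = 1 + 3 * t := by
  have : a % 3 = 1 ∨ a % 3 = 2 := by omega
  rcases this with h | h
  · obtain ⟨k, rfl⟩ : ∃ k, a = 3 * k + 1 := ⟨a / 3, by omega⟩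
    exact ⟨3 * k ^ 2 + 2 * k, by ring⟩
  · obtain ⟨k, rfl⟩ : ∃ k, a = 3 * k + 2 := ⟨a / 3, by omega⟩
    exact ⟨3 * k ^ 2 + 4 * k + 1, by ring⟩

theorem nine_dvd_pow_six_sub_one {a b : ℤ} (ha : ¬ 3 ∣ a) (hb : ¬ 3 ∣ b) :
    ((9 : ℤ) : ℤ√(-3)) ∣ (⟨a, b⟩ : ℤ√(-3)) ^ 6 - 1 := by
  obtain ⟨t, ht⟩ := exists_sq_eq_one_add_three_mul ha
  obtain ⟨u, hu⟩ := exists_sq_eq_one_add_three_mul hb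
  rw [Zsqrtd.intCast_dvd, Zsqrtd_neg_three_pow_six]
  simp only [re_sub, im_sub, re_one, im_one]
  rw [show a ^ 6 = (a ^ 2) ^ 3 by ring, show a ^ 4 = (a ^ 2) ^ 2 by ring,
    show b ^ 6 = (b ^ 2) ^ 3 by ring, show b ^ 4 = (b ^ 2) ^ 2 by ring, ht, hu]
  constructor
  · exact ⟨t + 3 * t ^ 2 + 3 * t ^ 3 - 5 * (1 + 3 * t) ^ 2 * (1 + 3 * u) +
      15 * (1 + 3 * t) * (1 + 3 * u) ^ 2 - 3 * (1 + 3 * u) ^ 3, by ring⟩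
  · exact ⟨2 * a * b * (2 * t + 3 * t ^ 2 - 3 - 10 * t - 10 * u - 30 * t * u +
      3 * (1 + 3 * u) ^ 2), by ring⟩

/-- All the congruence arguments below go through this reduction of the exponent modulo m. -/
theorem dvd_pow_mul_add_im_sub {M c : ℤ} {z : ℤ√(-3)} {m : ℕ} (h : (M : ℤ√(-3)) ∣ z ^ m - c)
    (v r : ℕ) : M ∣ (z ^ (m * v + r)).im - c ^ v * (z ^ r).im := by
  have h1 : (M : ℤ√(-3)) ∣ (z ^ m) ^ v - (c : ℤ√(-3)) ^ v :=
    h.trans (sub_dvd_pow_sub_pow _ _ _)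
  obtain ⟨w, hw⟩ := h1
  refine ⟨(w * z ^ r).im, ?_⟩
  have h2 : z ^ (m * v + r) = ((c ^ v : ℤ) : ℤ√(-3)) * z ^ r + (M : ℤ√(-3)) * (w * z ^ r) := by
    rw [pow_add, pow_mul, ← mul_assoc, ← hw]
    push_cast
    ring
  rw [h2, im_add, im_smul, im_smul]
  ring

/-- Lifting the exponent: each cubing raises the power of 3 in z^(6·3^s) - 1 by one and keeps the
cofactor congruent to y modulo 3. -/
theorem exists_pow_three_pow_eq {z y : ℤ√(-3)} (h : z ^ 6 = 1 + 9 * y) (s : ℕ) :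
    ∃ w, z ^ (6 * 3 ^ s) = 1 + 3 ^ (s + 2) * (y + 3 * w) := by
  induction s with
  | zero => exact ⟨0, by rw [pow_zero, mul_one, h]; ring⟩
  | succ s ih =>
    obtain ⟨w, hw⟩ := ih
    refine ⟨w + 3 ^ (s + 1) * (y + 3 * w) ^ 2 + 3 ^ (2 * s + 2) * (y + 3 * w) ^ 3, ?_⟩
    rw [pow_succ 3 s, ← mul_assoc, pow_mul, hw]
    ring

theorem exists_one_add_pow_eq (s : ℕ) (x : ℤ√(-3)) (k : ℕ) :
    ∃ w, (1 + 3 ^ (s + 1) * x) ^ k = 1 + 3 ^ (s + 1) * (k * x + 3 * w) := by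
  induction k with
  | zero => exact ⟨0, by simp⟩
  | succ k ih =>
    obtain ⟨w, hw⟩ := ih
    refine ⟨w + 3 ^ s * (k * x + 3 * w) * x, ?_⟩
    rw [pow_succ, hw]
    push_cast
    ring

/-- For m = 3^s k with 3 ∤ k, the difference of the imaginary parts is 3^(s+2) times an integer
congruent to k·Im(yz) modulo 3, hence nonzero. -/
theorem pow_im_ne_im {z y : ℤ√(-3)} (h : z ^ 6 = 1 + 9 * y) (hy : ¬ (3 : ℤ) ∣ (y * z).im)
    {m : ℕ} (hm : m ≠ 0) : (z ^ (6 * m + 1)).im ≠ z.im := by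
  obtain ⟨s, k, hk, rfl⟩ := Nat.exists_eq_pow_mul_and_not_dvd hm 3 (by norm_num)
  obtain ⟨w, hw⟩ := exists_pow_three_pow_eq h s
  obtain ⟨v, hv⟩ := exists_one_add_pow_eq (s + 1) (y + 3 * w) k
  intro he
  have h1 : z ^ (6 * (3 ^ s * k) + 1) =
      z + ((3 ^ (s + 2) : ℤ) : ℤ√(-3)) * (((k : ℤ) : ℤ√(-3)) * (y * z) +
        ((3 : ℤ) : ℤ√(-3)) * ((k * w + v) * z)) := by
    rw [pow_succ, ← mul_assoc, pow_mul, hw, hv]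
    push_cast
    ring
  rw [h1, im_add, im_smul, im_add, im_smul, im_smul] at he
  have h2 : (3 : ℤ) ^ (s + 2) ≠ 0 := by positivity
  have h3 : (k : ℤ) * (y * z).im + 3 * ((k * w + v) * z).im = 0 := by
    have : (3 : ℤ) ^ (s + 2) * ((k : ℤ) * (y * z).im + 3 * ((k * w + v) * z).im) = 0 := by
      linarith
    exact (mul_eq_zero.1 this).resolve_left h2
  have h4 : (3 : ℤ) ∣ (k : ℤ) * (y * z).im := ⟨-((k * w + v) * z).im, by linarith⟩
  rcases Int.prime_three.dvd_or_dvd h4 with h5 | h5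
  · exact hk (Int.natCast_dvd_natCast.1 (by exact_mod_cast h5))
  · exact hy h5

/-- The equation `Im (a + b √-3) ^ n = b` with odd `n` has only the trivial solution if a certain
congruence modulo `27` fails. -/
theorem eq_one_of_pow_im_eq {a b : ℤ} (ha : ¬ 3 ∣ a) (hb : ¬ 3 ∣ b) {n : ℕ} (hn : Odd n)
    (h27 : ¬ (27 : ℤ) ∣ ((⟨a, b⟩ : ℤ√(-3)) ^ 7).im - b)
    (h : ((⟨a, b⟩ : ℤ√(-3)) ^ n).im = b) : n = 1 := by
  have h9 := nine_dvd_pow_six_sub_one ha hb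
  have h9' : ((9 : ℤ) : ℤ√(-3)) ∣ (⟨a, b⟩ : ℤ√(-3)) ^ 6 - ((1 : ℤ) : ℤ√(-3)) := by
    simpa using h9
  obtain ⟨t, ht⟩ := exists_sq_eq_one_add_three_mul ha
  obtain ⟨r, m, hr, rfl⟩ : ∃ r m, (r = 1 ∨ r = 3 ∨ r = 5) ∧ n = 6 * m + r := by
    refine ⟨n % 6, n / 6, ?_, by omega⟩
    obtain ⟨k, rfl⟩ := hn
    omega
  have hmod := dvd_pow_mul_add_im_sub h9' m r
  rw [one_pow, one_mul, h] at hmod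
  rcases hr with rfl | rfl | rfl
  -- As z⁷ = z + 9yz, the hypothesis modulo 27 says that 3 does not divide Im(yz).
  · obtain ⟨y, hy⟩ := h9
    have hy' : (⟨a, b⟩ : ℤ√(-3)) ^ 6 = 1 + 9 * y := by
      rw [← sub_add_cancel ((⟨a, b⟩ : ℤ√(-3)) ^ 6) 1, hy]
      push_cast
      ring
    by_contra hm
    refine pow_im_ne_im hy' ?_ (show m ≠ 0 by rintro rfl; simp at hm) h
    rintro ⟨u, hu⟩
    apply h27
    refine ⟨u, ?_⟩
    have : (⟨a, b⟩ : ℤ√(-3)) ^ 7 = ⟨a, b⟩ + ((9 : ℤ) : ℤ√(-3)) * (y * ⟨a, b⟩) := by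
      rw [pow_succ, hy']
      push_cast
      ring
    rw [this, im_add, im_smul, hu]
    ring
  -- For r = 3 the imaginary part is 0 modulo 3, and for r = 5 it is 2b; either would force 3 ∣ b.
  · rw [Zsqrtd_neg_three_pow_three] at hmod
    exfalso
    apply hb
    obtain ⟨u, hu⟩ := hmod
    exact ⟨3 * u + b * (a ^ 2 - b ^ 2), by linarith⟩
  · rw [Zsqrtd_neg_three_pow_five_im, show a ^ 4 = (a ^ 2) ^ 2 by ring, ht] at hmod
    exfalso
    apply hb
    obtain ⟨u, hu⟩ := hmod
    have : b = 3 * (-3 * u - b * (3 + 10 * t + 15 * t ^ 2 - 10 * (1 + 3 * t) * b ^ 2 + 3 * b ^ 4)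
      + 2 * b) := by
      linarith
    exact ⟨_, this⟩

theorem eq_one_of_pow_im_eq_one {a : ℤ} (ha : ¬ 3 ∣ a) {n : ℕ} (hn : Odd n)
    (h : ((⟨a, 1⟩ : ℤ√(-3)) ^ n).im = 1) : n = 1 := by
  refine eq_one_of_pow_im_eq ha (by norm_num) hn ?_ h
  obtain ⟨t, ht⟩ := exists_sq_eq_one_add_three_mul ha
  rw [Zsqrtd_neg_three_pow_seven_im, show a ^ 6 = (a ^ 2) ^ 3 by ring,
    show a ^ 4 = (a ^ 2) ^ 2 by ring, ht]
  -- As a polynomial in t, the difference is congruent to 9 modulo 27.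
  ring_nf
  omega

theorem eq_one_of_pow_im_eq_two {a : ℤ} (ha : ¬ 3 ∣ a) {n : ℕ} (hn : Odd n)
    (h : ((⟨a, 2⟩ : ℤ√(-3)) ^ n).im = 2) : n = 1 := by
  refine eq_one_of_pow_im_eq ha (by norm_num) hn ?_ h
  obtain ⟨t, ht⟩ := exists_sq_eq_one_add_three_mul ha
  rw [Zsqrtd_neg_three_pow_seven_im, show a ^ 6 = (a ^ 2) ^ 3 by ring,
    show a ^ 4 = (a ^ 2) ^ 2 by ring, ht]
  ring_nf
  omega

/-- For even a the square of a + √-3 is 1 modulo 4, so the odd powers have imaginary part 1 modulo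
4. -/
theorem pow_im_ne_neg_one {a : ℤ} (ha : Even a) {n : ℕ} (hn : Odd n) :
    ((⟨a, 1⟩ : ℤ√(-3)) ^ n).im ≠ -1 := by
  obtain ⟨k, rfl⟩ := ha
  obtain ⟨m, rfl⟩ := hn
  have h4 : ((4 : ℤ) : ℤ√(-3)) ∣ (⟨k + k, 1⟩ : ℤ√(-3)) ^ 2 - ((1 : ℤ) : ℤ√(-3)) := by
    rw [Zsqrtd.intCast_dvd, Zsqrtd_neg_three_pow_two]
    simp only [re_sub, im_sub, re_intCast, im_intCast]
    exact ⟨⟨k ^ 2 - 1, by ring⟩, ⟨k, by ring⟩⟩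
  have := dvd_pow_mul_add_im_sub h4 m 1
  intro h
  rw [h] at this
  simp at this

theorem exists_odd_sq {a : ℤ} (ha : Odd a) : ∃ s, a ^ 2 = 1 + 8 * s := by
  have h := Int.eight_dvd_sq_sub_one_of_odd ha
  obtain ⟨s, hs⟩ := h
  exact ⟨s, by linarith⟩

theorem sixteen_dvd_pow_eight_sub_one {a : ℤ} (ha : Odd a) :
    ((16 : ℤ) : ℤ√(-3)) ∣ (⟨a, 2⟩ : ℤ√(-3)) ^ 8 - ((1 : ℤ) : ℤ√(-3)) := by
  obtain ⟨s, hs⟩ := exists_odd_sq ha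
  rw [Zsqrtd.intCast_dvd, show 8 = 4 * 2 from rfl, pow_mul, Zsqrtd_neg_three_pow_four,
    Zsqrtd_neg_three_pow_two]
  simp only [re_sub, im_sub, re_intCast, im_intCast]
  rw [show (4 * a * 2 * (a ^ 2 - 3 * 2 ^ 2)) ^ 2 = 64 * a ^ 2 * (a ^ 2 - 12) ^ 2 by ring,
    show a ^ 4 = (a ^ 2) ^ 2 by ring, hs]
  constructor
  · ring_nf
    omega
  · exact ⟨a * (1 + 8 * s - 12) * ((1 + 8 * s) ^ 2 - 72 * (1 + 8 * s) + 144), by ring⟩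

/-- Working modulo 16 leaves only n ≡ 3 mod 8. In that class the imaginary part is a square modulo W
= a² - 12, whereas the Jacobi symbol of -2 modulo W is -1. -/
theorem pow_im_ne_neg_two {a : ℤ} (ha : Odd a) (ha3 : ¬ 3 ∣ a) {n : ℕ} (hn : Odd n) :
    ((⟨a, 2⟩ : ℤ√(-3)) ^ n).im ≠ -2 := by
  intro h
  -- For a² = 1 the modulus a² - 12 is negative; this case is settled modulo 9.
  by_cases ha1 : a ^ 2 = 1
  · obtain ⟨r, m, hr, rfl⟩ : ∃ r m, (r = 1 ∨ r = 3 ∨ r = 5) ∧ n = 6 * m + r := by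
      refine ⟨n % 6, n / 6, ?_, by omega⟩
      obtain ⟨k, rfl⟩ := hn
      omega
    have h9 : ((9 : ℤ) : ℤ√(-3)) ∣ (⟨a, 2⟩ : ℤ√(-3)) ^ 6 - ((1 : ℤ) : ℤ√(-3)) := by
      simpa using nine_dvd_pow_six_sub_one ha3 (by norm_num : ¬ (3 : ℤ) ∣ 2)
    have hmod := dvd_pow_mul_add_im_sub h9 m r
    rw [one_pow, one_mul, h] at hmod
    rcases hr with rfl | rfl | rfl
    · simp at hmod
    · rw [Zsqrtd_neg_three_pow_three, ha1] at hmod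
      norm_num at hmod
    · rw [Zsqrtd_neg_three_pow_five_im, show a ^ 4 = (a ^ 2) ^ 2 by ring, ha1] at hmod
      norm_num at hmod
  obtain ⟨s, hs⟩ := exists_odd_sq ha
  obtain ⟨r, v, hr, rfl⟩ : ∃ r v, (r = 1 ∨ r = 3 ∨ r = 5 ∨ r = 7) ∧ n = 8 * v + r := by
    refine ⟨n % 8, n / 8, ?_, by omega⟩
    obtain ⟨k, rfl⟩ := hn
    omega
  have hr3 : r = 3 := by
    have hmod := dvd_pow_mul_add_im_sub (sixteen_dvd_pow_eight_sub_one ha) v r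
    rw [one_pow, one_mul, h] at hmod
    rcases hr with rfl | rfl | rfl | rfl
    · simp at hmod
    · rfl
    · rw [Zsqrtd_neg_three_pow_five_im, show a ^ 4 = (a ^ 2) ^ 2 by ring, hs] at hmod
      ring_nf at hmod
      omega
    · rw [Zsqrtd_neg_three_pow_seven_im, show a ^ 6 = (a ^ 2) ^ 3 by ring,
        show a ^ 4 = (a ^ 2) ^ 2 by ring, hs] at hmod
      ring_nf at hmod
      omega
  subst hr3
  have hW : 12 < a ^ 2 := by
    by_contra hlt
    have h1 : a < 4 := by nlinarith
    have h2 : -4 < a := by nlinarith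
    interval_cases a <;> revert ha ha3 ha1 <;> decide
  obtain ⟨W, hWa⟩ : ∃ W : ℕ, (W : ℤ) = a ^ 2 - 12 := ⟨(a ^ 2 - 12).toNat, by omega⟩
  have h4 : ((W : ℤ) : ℤ√(-3)) ∣ (⟨a, 2⟩ : ℤ√(-3)) ^ 4 - ((-576 : ℤ) : ℤ√(-3)) := by
    rw [Zsqrtd.intCast_dvd, Zsqrtd_neg_three_pow_four, hWa]
    simp only [re_sub, im_sub, re_intCast, im_intCast]
    exact ⟨⟨a ^ 2 - 60, by ring⟩, ⟨8 * a, by ring⟩⟩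
  have hmod := dvd_pow_mul_add_im_sub h4 (2 * v) 3
  rw [show 4 * (2 * v) + 3 = 8 * v + 3 by ring, h, Zsqrtd_neg_three_pow_three] at hmod
  obtain ⟨u, hu⟩ := hmod
  have hsq : (-2 - (2 * a * (-576) ^ v) ^ 2) % (W : ℤ) = 0 := by
    apply Int.emod_eq_zero_of_dvd
    -- The imaginary part of the cube is 6a² - 24 = (2a)² + 2W.
    refine ⟨u + 2 * ((-576) ^ (2 * v)), ?_⟩
    simp only at hu
    have e : ((-576 : ℤ) ^ v) ^ 2 = (-576) ^ (2 * v) := by rw [← pow_mul, mul_comm]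
    rw [mul_pow, e, mul_add, ← hu, hWa]
    ring
  have hJ : jacobiSym (-2) W = jacobiSym (2 * a * (-576) ^ v) W ^ 2 := by
    rw [← jacobiSym.pow_left]
    exact jacobiSym.mod_left' (Int.emod_eq_emod_iff_emod_sub_eq_zero.2 hsq)
  -- a² ≡ 1 mod 8 gives W ≡ -11 ≡ 5 mod 8.
  have hW8 : W % 8 = 5 := by omega
  rw [jacobiSym.at_neg_two (Nat.odd_iff.2 (by omega)), ZMod.χ₈'_nat_eq_if_mod_eight, hW8] at hJ
  norm_num at hJ
  rw [if_neg (by omega)] at hJ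
  nlinarith [sq_nonneg (jacobiSym (2 * a * (-576) ^ v) W)]

/-! ### Elements of norm pⁿ in ℤ[√-3]. -/

theorem eq_of_intCast_mul_eq {p : ℤ} (hp : p ≠ 0) {x y : ℤ√(-3)}
    (h : (p : ℤ√(-3)) * x = (p : ℤ√(-3)) * y) : x = y := by
  rw [Zsqrtd.ext_iff, re_smul, im_smul, re_smul, im_smul] at h
  exact Zsqrtd.ext (mul_left_cancel₀ hp h.1) (mul_left_cancel₀ hp h.2)

/-- This replaces unique factorisation, which fails in ℤ[√-3]. If p divides Im(z·star y) for y of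
norm p, it divides the real part as well, by the norm equation; then p = y·star y gives y ∣ z. -/
theorem dvd_or_star_dvd_of_norm_eq {p : ℕ} (hp : p.Prime) {π z : ℤ√(-3)} (hπ : π.norm = p)
    {m : ℤ} (hz : z.norm = p * m) : π ∣ z ∨ star π ∣ z := by
  have hp' : Prime (p : ℤ) := Nat.prime_iff_prime_int.1 hp
  have key : ∀ y : ℤ√(-3), y.norm = p → (p : ℤ) ∣ (z * star y).im → y ∣ z := by
    intro y hy him
    have hn : (z * star y).norm = p * (p * m) := by
      rw [Zsqrtd.norm_mul, Zsqrtd.norm_conj, hz, hy]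
      ring
    rw [Zsqrtd.norm_def] at hn
    have hre : (p : ℤ) ∣ (z * star y).re := by
      have : (p : ℤ) ∣ (z * star y).re * (z * star y).re := by
        obtain ⟨u, hu⟩ := him
        exact ⟨p * m - 3 * u * (z * star y).im, by rw [hu] at hn ⊢; linarith⟩
      exact (hp'.dvd_or_dvd this).elim id id
    obtain ⟨w, hw⟩ := (Zsqrtd.intCast_dvd _ _).2 ⟨hre, him⟩
    refine ⟨w, eq_of_intCast_mul_eq hp'.ne_zero ?_⟩
    have h1 := Zsqrtd.norm_eq_mul_conj y
    rw [hy] at h1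
    rw [mul_left_comm, ← hw, h1]
    ring
  -- The product is (Im z)²(Re π)² - (Re z)²(Im π)²; the norm equations turn it into a multiple of
  -- p.
  have hprod : (p : ℤ) ∣ (z * star π).im * (z * star (star π)).im := by
    rw [Zsqrtd.norm_def] at hπ hz
    simp only [im_mul, re_star, im_star, neg_neg]
    exact ⟨z.im * z.im - π.im * π.im * m, by linear_combination z.im * z.im * hπ - π.im * π.im * hz⟩
  rcases hp'.dvd_or_dvd hprod with h | h
  · exact Or.inl (key π hπ h)
  · exact Or.inr (key (star π) (by rw [Zsqrtd.norm_conj, hπ]) h)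

theorem eq_pow_or_eq_neg_pow_of_norm_eq {p : ℕ} (hp : p.Prime) {π : ℤ√(-3)} (hπ : π.norm = p)
    (n : ℕ) (z : ℤ√(-3)) (hz : z.norm = p ^ n) (hzπ : ¬ star π ∣ z) :
    z = π ^ n ∨ z = -π ^ n := by
  induction n generalizing z with
  | zero =>
    rw [pow_zero, Zsqrtd.norm_def] at hz
    have him : z.im = 0 := by nlinarith [sq_nonneg z.re, sq_nonneg z.im]
    rw [him] at hz
    have hre : z.re = 1 ∨ z.re = -1 := by
      rw [← sq_eq_one_iff]
      linarith
    rw [pow_zero]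
    rcases hre with h | h
    · exact Or.inl (Zsqrtd.ext h him)
    · exact Or.inr (Zsqrtd.ext h (by simpa using him))
  | succ n ih =>
    obtain ⟨w, rfl⟩ := (dvd_or_star_dvd_of_norm_eq hp hπ
      (by rw [hz, pow_succ']) : π ∣ z ∨ star π ∣ z).resolve_right hzπ
    have hw : w.norm = (p : ℤ) ^ n := by
      rw [Zsqrtd.norm_mul, hπ, pow_succ'] at hz
      exact mul_left_cancel₀ (Int.natCast_ne_zero.2 hp.ne_zero) hz
    rcases ih w hw (fun h => hzπ (h.mul_left _)) with h | h
    · exact Or.inl (by rw [h, pow_succ'])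
    · exact Or.inr (by rw [h, pow_succ', mul_neg])

/-- The representations `p ^ n = X ^ 2 + 3 Y ^ 2` with `p` not dividing `Y` come from those of
`p`. -/
theorem exists_im_pow_eq {p : ℕ} (hp : p.Prime) (hp5 : 5 ≤ p) {a b : ℤ}
    (hab : (p : ℤ) = a ^ 2 + 3 * b ^ 2) {n : ℕ} {X Y : ℤ}
    (h : (p : ℤ) ^ n = X ^ 2 + 3 * Y ^ 2) (hY : ¬ (p : ℤ) ∣ Y) :
    ((⟨a, b⟩ : ℤ√(-3)) ^ n).im = Y ∨ ((⟨a, b⟩ : ℤ√(-3)) ^ n).im = -Y := by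
  have hp' : Prime (p : ℤ) := Nat.prime_iff_prime_int.1 hp
  set π : ℤ√(-3) := ⟨a, b⟩ with hπdef
  have hπ : π.norm = p := by rw [Zsqrtd.norm_def, hab, hπdef]; ring
  have hπs : (star π).norm = p := by rw [Zsqrtd.norm_conj, hπ]
  set z : ℤ√(-3) := ⟨X, Y⟩ with hzdef
  have hz : z.norm = (p : ℤ) ^ n := by rw [Zsqrtd.norm_def, h, hzdef]; ring
  -- If both conjugates divided z, then p would divide (π + star π)z = 2az and hence 2aY, whereas p
  -- divides none of 2, a, Y.
  have hor : ¬ star π ∣ z ∨ ¬ star (star π) ∣ z := by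
    by_contra! hc
    rw [star_star] at hc
    obtain ⟨⟨u, hu⟩, ⟨v, hv⟩⟩ := hc
    have h1 := Zsqrtd.norm_eq_mul_conj π
    rw [hπ] at h1
    have h2 : ((2 * a : ℤ) : ℤ√(-3)) * z = ((p : ℤ) : ℤ√(-3)) * (u + v) := by
      have : ((2 * a : ℤ) : ℤ√(-3)) = π + star π := by
        ext <;> simp [hπdef]; ring
      rw [this, add_mul, mul_add, h1]
      nth_rewrite 1 [hu]
      rw [hv]
      ring
    have h3 := congrArg Zsqrtd.im h2
    rw [im_smul, im_smul] at h3
    have h4 : (p : ℤ) ∣ 2 * a * Y := ⟨_, h3⟩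
    rcases hp'.dvd_or_dvd h4 with h5 | h5
    · rcases hp'.dvd_or_dvd h5 with h6 | h6
      · have := Int.le_of_dvd (by norm_num) h6
        omega
      · have ha : a ≠ 0 := by
          rintro rfl
          have : (p : ℤ) ∣ 3 * (b * b) := by rw [hab]; exact ⟨1, by ring⟩
          rcases hp'.dvd_or_dvd this with h7 | h7
          · have := Int.le_of_dvd (by norm_num) h7
            omega
          · obtain ⟨c, rfl⟩ := (hp'.dvd_or_dvd h7).elim id id
            have hc : c ≠ 0 := by rintro rfl; simp at hab; omega
            have h8 : (1 : ℤ) ≤ c ^ 2 := Int.add_one_le_of_lt (show (0 : ℤ) < _ ^ 2 by positivity)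
            have h9 : (p : ℤ) ^ 2 * 1 ≤ p ^ 2 * c ^ 2 :=
              mul_le_mul_of_nonneg_left h8 (by positivity)
            nlinarith
        obtain ⟨c, hc⟩ := h6
        have hc0 : c ≠ 0 := by rintro rfl; simp at hc; exact ha hc
        have : 0 < c ^ 2 := by positivity
        have h8 : a ^ 2 = p ^ 2 * c ^ 2 := by rw [hc]; ring
        nlinarith [sq_nonneg b]
    · exact hY h5
  rcases hor with h1 | h1
  · rcases eq_pow_or_eq_neg_pow_of_norm_eq hp hπ n z hz h1 with h2 | h2
    · exact Or.inl (congrArg Zsqrtd.im h2).symm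
    · exact Or.inr (by have := congrArg Zsqrtd.im h2; simp only [im_neg, hzdef] at this; linarith)
  · rcases eq_pow_or_eq_neg_pow_of_norm_eq hp hπs n z hz h1 with h2 | h2
    · rw [← star_pow] at h2
      exact Or.inr (by have := congrArg Zsqrtd.im h2; simp only [im_star, hzdef] at this; linarith)
    · rw [← star_pow] at h2
      exact Or.inl (by
        have := congrArg Zsqrtd.im h2
        simp only [im_star, im_neg, hzdef] at this
        linarith)

theorem im_pow_neg (a b : ℤ) (n : ℕ) :
    ((⟨a, -b⟩ : ℤ√(-3)) ^ n).im = -((⟨a, b⟩ : ℤ√(-3)) ^ n).im := by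
  rw [← im_star, star_pow]
  rfl

/-- Used to bound b: it must divide 1 or 2. -/
theorem im_dvd_im_pow (z : ℤ√(-3)) (n : ℕ) : z.im ∣ (z ^ n).im := by
  induction n with
  | zero => simp
  | succ n ih =>
    rw [pow_succ, im_mul]
    exact dvd_add (dvd_mul_left _ _) (ih.mul_right _)

theorem eq_one_of_pow_eq_sq_add_three_of_odd {p : ℕ} (hp : p.Prime) (hp5 : 5 ≤ p) {a b : ℤ}
    (hab : (p : ℤ) = a ^ 2 + 3 * b ^ 2) {n : ℕ} (hn : Odd n) {x : ℤ}
    (h : (p : ℤ) ^ n = x ^ 2 + 3) : n = 1 := by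
  have hodd : Odd (p : ℤ) := by
    exact_mod_cast hp.odd_of_ne_two (by omega)
  have ha3 : ¬ 3 ∣ a := by
    rintro ⟨c, rfl⟩
    have : (3 : ℤ) ∣ p := ⟨3 * c ^ 2 + b ^ 2, by rw [hab]; ring⟩
    have := (Nat.prime_dvd_prime_iff_eq Nat.prime_three hp).1 (by exact_mod_cast this)
    omega
  have hp1 : ¬ (p : ℤ) ∣ 1 := fun hd => by
    have := Int.le_of_dvd one_pos hd
    omega
  have him := exists_im_pow_eq hp hp5 hab (by rw [h]; ring : (p : ℤ) ^ n = x ^ 2 + 3 * 1 ^ 2) hp1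
  have hb : b = 1 ∨ b = -1 := by
    have hd : b ∣ ((⟨a, b⟩ : ℤ√(-3)) ^ n).im := im_dvd_im_pow ⟨a, b⟩ n
    have : b ∣ 1 := him.elim (fun e => e ▸ hd) (fun e => by rw [e] at hd; simpa using hd)
    exact Int.isUnit_iff.1 (isUnit_of_dvd_one this)
  have ha2 : Even a := by
    have : Even (a ^ 2) := by
      rcases hb with rfl | rfl <;>
      · obtain ⟨k, hk⟩ := hodd
        exact ⟨k - 1, by linarith⟩
    rwa [Int.even_pow' (by norm_num)] at this
  have fin : ((⟨a, 1⟩ : ℤ√(-3)) ^ n).im = 1 ∨ ((⟨a, 1⟩ : ℤ√(-3)) ^ n).im = -1 := by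
    rcases hb with rfl | rfl
    · exact him
    · rw [im_pow_neg] at him
      omega
  exact eq_one_of_pow_im_eq_one ha3 hn (fin.resolve_right (pow_im_ne_neg_one ha2 hn))

theorem eq_one_of_pow_eq_sq_add_twelve_of_odd {p : ℕ} (hp : p.Prime) (hp5 : 5 ≤ p) {a b : ℤ}
    (hab : (p : ℤ) = a ^ 2 + 3 * b ^ 2) {n : ℕ} (hn : Odd n) {x : ℤ}
    (h : (p : ℤ) ^ n = x ^ 2 + 12) : n = 1 := by
  have hodd : Odd (p : ℤ) := by
    exact_mod_cast hp.odd_of_ne_two (by omega)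
  have ha3 : ¬ 3 ∣ a := by
    rintro ⟨c, rfl⟩
    have : (3 : ℤ) ∣ p := ⟨3 * c ^ 2 + b ^ 2, by rw [hab]; ring⟩
    have := (Nat.prime_dvd_prime_iff_eq Nat.prime_three hp).1 (by exact_mod_cast this)
    omega
  have hp2 : ¬ (p : ℤ) ∣ 2 := fun hd => by
    have := Int.le_of_dvd two_pos hd
    omega
  have him := exists_im_pow_eq hp hp5 hab (by rw [h]; ring : (p : ℤ) ^ n = x ^ 2 + 3 * 2 ^ 2) hp2
  have hb2 : b ∣ 2 := by
    have hd : b ∣ ((⟨a, b⟩ : ℤ√(-3)) ^ n).im := im_dvd_im_pow ⟨a, b⟩ n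
    exact him.elim (fun e => e ▸ hd) (fun e => by rw [e] at hd; simpa using hd)
  -- If b is odd, then a is even and the square of a + b√-3 is 1 modulo 2, so odd powers have odd
  -- imaginary part and ±2 is not reached.
  have hbo : ¬ Odd b := by
    intro hbo
    have ha2 : Even a := by
      have : Even (a ^ 2) := by
        rw [show a ^ 2 = p - 3 * b ^ 2 by linarith]
        exact hodd.sub_odd ((by decide : Odd (3 : ℤ)).mul hbo.pow)
      rwa [Int.even_pow' (by norm_num)] at this
    have key : Odd ((⟨a, b⟩ : ℤ√(-3)) ^ n).im := by
      obtain ⟨m, rfl⟩ := hn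
      obtain ⟨k, rfl⟩ := ha2
      obtain ⟨l, rfl⟩ := hbo
      have h2 : ((2 : ℤ) : ℤ√(-3)) ∣ (⟨k + k, 2 * l + 1⟩ : ℤ√(-3)) ^ 2 - ((1 : ℤ) : ℤ√(-3)) := by
        rw [Zsqrtd.intCast_dvd, Zsqrtd_neg_three_pow_two]
        simp only [re_sub, im_sub, re_intCast, im_intCast]
        exact ⟨⟨2 * k ^ 2 - 6 * l ^ 2 - 6 * l - 2, by ring⟩, ⟨(k + k) * (2 * l + 1), by ring⟩⟩
      have := dvd_pow_mul_add_im_sub h2 m 1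
      rw [one_pow, one_mul, pow_one] at this
      rw [Int.odd_iff]
      simp only at this
      omega
    rcases him with e | e <;> rw [e] at key <;> revert key <;> decide
  have hb : b = 2 ∨ b = -2 := by
    have h1 := Int.le_of_dvd two_pos hb2
    have h2 := Int.le_of_dvd two_pos (neg_dvd.2 hb2)
    rw [Int.not_odd_iff_even] at hbo
    obtain ⟨k, rfl⟩ := hbo
    have : k ≠ 0 := by rintro rfl; simp at hb2
    omega
  have ha2 : Odd a := by
    have : Odd (a ^ 2) := by
      rcases hb with rfl | rfl <;>
      · obtain ⟨k, hk⟩ := hodd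
        exact ⟨k - 6, by linarith⟩
    rwa [Int.odd_pow' (by norm_num)] at this
  have fin : ((⟨a, 2⟩ : ℤ√(-3)) ^ n).im = 2 ∨ ((⟨a, 2⟩ : ℤ√(-3)) ^ n).im = -2 := by
    rcases hb with rfl | rfl
    · exact him
    · rw [im_pow_neg] at him
      omega
  exact eq_one_of_pow_im_eq_two ha3 hn (fin.resolve_right (pow_im_ne_neg_two ha2 ha3 hn))

/-- A prime `p ≡ 1 mod 3` has the form `a ^ 2 + 3 b ^ 2`. -/
theorem exists_eq_sq_add_three_mul_sq {p : ℕ} (hp : p.Prime) (h3 : 3 ∣ p - 1) :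
    ∃ a b : ℤ, (p : ℤ) = a ^ 2 + 3 * b ^ 2 := by
  have := Fact.mk hp
  obtain ⟨g, hg⟩ := IsCyclic.exists_generator (α := (ZMod p)ˣ)
  obtain ⟨f, A, B, C, D, h⟩ := exists_isInterNumbers (F := ZMod p) (by rwa [ZMod.card]) hg
  have h4 := h.four_mul_card
  rw [ZMod.card] at h4
  generalize 9 * A - (p : ℤ) + 8 = c at h4
  generalize C - B = d at h4
  have hpar : (c - d) % 2 = 0 := by
    have h5 : (c ^ 2 + 27 * d ^ 2) % 2 = 0 := by omega
    rcases Int.even_or_odd c with ⟨k, rfl⟩ | ⟨k, rfl⟩ <;>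
    rcases Int.even_or_odd d with ⟨l, rfl⟩ | ⟨l, rfl⟩ <;> ring_nf at h5 ⊢ <;> omega
  rcases Int.even_or_odd c with ⟨k, rfl⟩ | ⟨k, rfl⟩
  · obtain ⟨l, rfl⟩ : ∃ l, d = l + l := ⟨d / 2, by omega⟩
    exact ⟨k, 3 * l, by linarith⟩
  -- For odd c, d, multiplying (c + 3d√-3)/2 by one of the units (1 ± √-3)/2 lands in ℤ[√-3]; which
  -- one depends on c - d modulo 4.
  · obtain ⟨l, rfl⟩ : ∃ l, d = 2 * l + 1 := ⟨d / 2, by omega⟩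
    rcases Int.even_or_odd (k - l) with ⟨j, hj⟩ | ⟨j, hj⟩
    · obtain rfl : k = l + 2 * j := by omega
      exact ⟨j - 4 * l - 2, 2 * l + j + 1, by linarith⟩
    · obtain rfl : k = l + (2 * j + 1) := by omega
      exact ⟨5 * l + j + 3, j - l, by linarith⟩

/-- A square root s of -3 modulo p yields the primitive cube root of unity (s - 1)/2, whose order 3
divides p - 1. -/
theorem three_dvd_sub_one_of_dvd_sq_add {p : ℕ} (hp : p.Prime) (hp5 : 5 ≤ p) {x y : ℤ}
    (h : (p : ℤ) ∣ x ^ 2 + 3 * y ^ 2) (hy : ¬ (p : ℤ) ∣ y) : 3 ∣ p - 1 := by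
  have := Fact.mk hp
  have hy0 : (y : ZMod p) ≠ 0 := by rwa [Ne, ZMod.intCast_zmod_eq_zero_iff_dvd]
  have h2 : (2 : ZMod p) ≠ 0 := by
    have h22 : ((2 : ℕ) : ZMod p) ≠ 0 := by
      rw [Ne, ZMod.natCast_eq_zero_iff]
      exact fun hd => by have := Nat.le_of_dvd two_pos hd; omega
    exact_mod_cast h22
  have h3 : (3 : ZMod p) ≠ 0 := by
    have h33 : ((3 : ℕ) : ZMod p) ≠ 0 := by
      rw [Ne, ZMod.natCast_eq_zero_iff]
      exact fun hd => by have := Nat.le_of_dvd three_pos hd; omega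
    exact_mod_cast h33
  have h0 : (x : ZMod p) ^ 2 + 3 * (y : ZMod p) ^ 2 = 0 := by
    have := (ZMod.intCast_zmod_eq_zero_iff_dvd (x ^ 2 + 3 * y ^ 2) p).2 h
    exact_mod_cast this
  set s : ZMod p := x / y with hs
  have hs3 : s ^ 2 = -3 := by
    rw [hs, div_pow, div_eq_iff (pow_ne_zero 2 hy0)]
    linear_combination h0
  set w : ZMod p := (s - 1) / 2 with hw
  have hw1 : w ^ 2 + w + 1 = 0 := by
    rw [hw]
    field_simp
    linear_combination hs3
  have hw3 : w ^ 3 = 1 := by linear_combination (w - 1) * hw1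
  have hwne : w ≠ 1 := by
    intro h1
    rw [h1] at hw1
    exact h3 (by linear_combination hw1)
  have ho : orderOf w = 3 := orderOf_eq_prime hw3 hwne
  have hw0 : w ≠ 0 := by
    intro h1
    rw [h1] at hw1
    simp at hw1
  rw [← ho]
  exact orderOf_dvd_of_pow_eq_one (ZMod.pow_card_sub_one_eq_one hw0)

theorem two_pow_le_two_of_eq_sq_add_three {n : ℕ} {x : ℤ} (h : (2 : ℤ) ^ n = x ^ 2 + 3) :
    n ≤ 2 := by
  by_contra! hn
  obtain ⟨m, rfl⟩ := Nat.exists_eq_add_of_le hn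
  rw [pow_add] at h
  rcases Int.even_or_odd x with ⟨k, rfl⟩ | hx
  · ring_nf at h
    omega
  · obtain ⟨s, hs⟩ := exists_odd_sq hx
    rw [hs] at h
    norm_num at h
    omega

/-- The equation `x ^ 2 + 3 y ^ 2 = p ^ n` with `y ^ 2 ∈ {1, 4}`, reduced to odd `n`. -/
theorem odd_of_pow_eq_sq_add {p : ℕ} (hp : p.Prime) (hp5 : 5 ≤ p) {n : ℕ} (hn : n ≠ 0) {x : ℤ}
    (h : (p : ℤ) ^ n = x ^ 2 + 3 ∨ (p : ℤ) ^ n = x ^ 2 + 12) : Odd n := by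
  by_contra hodd
  obtain ⟨m, rfl⟩ := Nat.not_odd_iff_even.1 hodd
  have hm : m ≠ 0 := by rintro rfl; exact hn rfl
  have hy : (5 : ℤ) ≤ p ^ m := by
    have : p ^ 1 ≤ p ^ m := Nat.pow_le_pow_right hp.pos (Nat.one_le_iff_ne_zero.2 hm)
    rw [pow_one] at this
    exact_mod_cast hp5.trans this
  have hyo : Odd ((p : ℤ) ^ m) := by
    exact_mod_cast (hp.odd_of_ne_two (by omega)).pow
  rw [pow_add] at h
  generalize (p : ℤ) ^ m = y at *
  rw [← sq_abs x] at h
  have hx0 := abs_nonneg x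
  generalize |x| = z at *
  -- Now y² - z² is 3 or 12 with y ≥ 5. The gap is at least 2y - 1 ≥ 9, and at least 4y - 4 ≥ 16
  -- when z is odd like y.
  have hzy : z < y := by rcases h with h | h <;> nlinarith
  rcases h with h | h
  · nlinarith
  · have hzo : Odd z := by
      have : Odd (z ^ 2) := by
        rw [show z ^ 2 = y * y - 12 by linarith]
        exact (hyo.mul hyo).sub_even (by decide)
      rwa [Int.odd_pow' (by norm_num)] at this
    have : z + 2 ≤ y := by
      obtain ⟨k, rfl⟩ := hyo
      obtain ⟨l, rfl⟩ := hzo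
      omega
    nlinarith

theorem eq_one_of_pow_eq_sq_add_three {p n : ℕ} (hp : p.Prime) (hn : n ≠ 0) (hp3 : p ≠ 3)
    (h4 : p ^ n ≠ 4) {x : ℤ} (h : (p : ℤ) ^ n = x ^ 2 + 3) : n = 1 := by
  rcases eq_or_ne p 2 with rfl | hp2
  · have := two_pow_le_two_of_eq_sq_add_three (by exact_mod_cast h)
    have : n ≠ 2 := by rintro rfl; exact h4 rfl
    omega
  have hp5 : 5 ≤ p := by
    have := hp.two_le
    have : p ≠ 4 := by rintro rfl; revert hp; decide
    omega
  have hdvd : 3 ∣ p - 1 := by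
    refine three_dvd_sub_one_of_dvd_sq_add (x := x) (y := 1) hp hp5 ?_ ?_
    · rw [show x ^ 2 + 3 * 1 ^ 2 = (p : ℤ) ^ n by rw [h]; ring]
      exact dvd_pow_self _ hn
    · exact fun hd => by have := Int.le_of_dvd one_pos hd; omega
  obtain ⟨a, b, hab⟩ := exists_eq_sq_add_three_mul_sq hp hdvd
  exact eq_one_of_pow_eq_sq_add_three_of_odd hp hp5 hab
    (odd_of_pow_eq_sq_add hp hp5 hn (Or.inl h)) h

theorem eq_one_of_pow_eq_sq_add_twelve {p n : ℕ} (hp : p.Prime) (hn : n ≠ 0) (hp3 : p ≠ 3)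
    (h16 : p ^ n ≠ 16) {x : ℤ} (h : (p : ℤ) ^ n = x ^ 2 + 12) : n = 1 := by
  rcases eq_or_ne p 2 with rfl | hp2
  · exfalso
    have hx : Even x := by
      have : Even (x ^ 2) := by
        rw [show x ^ 2 = (2 : ℤ) ^ n - 12 by push_cast at h; linarith]
        exact (even_two.pow_of_ne_zero hn).sub (by decide)
      rwa [Int.even_pow' (by norm_num)] at this
    obtain ⟨k, rfl⟩ := hx
    -- Dividing by 4 reduces to 2^m = k² + 3, whose only admissible value 4 corresponds to 16.
    have h2 : 2 ≤ n := by
      by_contra! hlt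
      interval_cases n <;> push_cast at h <;> nlinarith [sq_nonneg k]
    obtain ⟨m, rfl⟩ := Nat.exists_eq_add_of_le h2
    have h5 : (2 : ℤ) ^ m = k ^ 2 + 3 := by
      rw [pow_add] at h
      push_cast at h
      linarith
    have hm := two_pow_le_two_of_eq_sq_add_three h5
    interval_cases m
    · nlinarith [sq_nonneg k]
    · nlinarith [sq_nonneg k]
    · exact h16 rfl
  have hp5 : 5 ≤ p := by
    have := hp.two_le
    have : p ≠ 4 := by rintro rfl; revert hp; decide
    omega
  have hdvd : 3 ∣ p - 1 := by
    refine three_dvd_sub_one_of_dvd_sq_add (x := x) (y := 2) hp hp5 ?_ ?_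
    · rw [show x ^ 2 + 3 * 2 ^ 2 = (p : ℤ) ^ n by rw [h]; ring]
      exact dvd_pow_self _ hn
    · exact fun hd => by have := Int.le_of_dvd two_pos hd; omega
  obtain ⟨a, b, hab⟩ := exists_eq_sq_add_three_mul_sq hp hdvd
  exact eq_one_of_pow_eq_sq_add_twelve_of_odd hp hp5 hab
    (odd_of_pow_eq_sq_add hp hp5 hn (Or.inr h)) h

/-- The representation `4 p = c ^ 2 + 27 d ^ 2` of a prime is unique up to signs. -/
theorem sq_eq_sq_of_four_mul_eq {p : ℕ} (hp : p.Prime) {c d c' d' : ℤ}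
    (h : 4 * (p : ℤ) = c ^ 2 + 27 * d ^ 2) (h' : 4 * (p : ℤ) = c' ^ 2 + 27 * d' ^ 2) :
    c ^ 2 = c' ^ 2 ∧ d ^ 2 = d' ^ 2 := by
  have hp' : Prime (p : ℤ) := Nat.prime_iff_prime_int.1 hp
  have hpos : (0 : ℤ) < p := by exact_mod_cast hp.pos
  have hdvd : (p : ℤ) ∣ (c * d' - c' * d) * (c * d' + c' * d) :=
    ⟨4 * d' ^ 2 - 4 * d ^ 2, by linear_combination (-d' ^ 2) * h + d ^ 2 * h'⟩
  have key : ∀ e : ℤ, e ^ 2 = c' ^ 2 → (p : ℤ) ∣ c * d' - e * d → c * d' = e * d := by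
    rintro e he ⟨k, hk⟩
    have h1 : (c * e + 27 * d * d') ^ 2 + 27 * (c * d' - e * d) ^ 2 = 16 * (p : ℤ) ^ 2 := by
      linear_combination (c ^ 2 + 27 * d ^ 2) * he - (c' ^ 2 + 27 * d' ^ 2) * h - 4 * (p : ℤ) * h'
    rw [hk] at h1
    -- Otherwise the left side of `h1` is at least 27p², exceeding 16p².
    have h2 : k = 0 := by
      by_contra hk0
      have h3 : (1 : ℤ) ≤ k ^ 2 := Int.add_one_le_of_lt (show (0 : ℤ) < _ ^ 2 by positivity)
      have h4 : (p : ℤ) ^ 2 * 1 ≤ p ^ 2 * k ^ 2 := mul_le_mul_of_nonneg_left h3 (by positivity)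
      nlinarith [sq_nonneg (c * e + 27 * d * d')]
    rw [h2] at hk
    linarith
  have hcd : (c * d') ^ 2 = (c' * d) ^ 2 := by
    rcases hp'.dvd_or_dvd hdvd with h1 | h1
    · rw [key c' rfl h1]
    · rw [key (-c') (by ring) (by rwa [neg_mul, sub_neg_eq_add])]
      ring
  have hd : d ^ 2 = d' ^ 2 := by
    have : (4 * (p : ℤ)) * (d' ^ 2 - d ^ 2) = 0 := by
      linear_combination hcd + d' ^ 2 * h - d ^ 2 * h'
    rcases mul_eq_zero.1 this with h1 | h1 <;> linarith
  exact ⟨by linarith, hd⟩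

end Diophantine
end DezaCyclotomic

namespace DezaCyclotomic

/-! ### From intersection numbers to the arithmetic conditions on q. -/

section Main

variable {F : Type*} [Field F] [Fintype F] {α : Fˣ} {f A B C D : ℤ}

theorem exists_prime_pow_eq_card (h3 : 3 ∣ Fintype.card F - 1) :
    ∃ p n : ℕ, p.Prime ∧ n ≠ 0 ∧ p ≠ 3 ∧ Fintype.card F = p ^ n := by
  obtain ⟨p, n, hp, hn, hq⟩ :=
    (isPrimePow_nat_iff _).1 (Fintype.nonempty_field_iff.1 ⟨(inferInstance : Field F)⟩)
  refine ⟨p, n, hp, hn.ne', ?_, hq.symm⟩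
  rintro rfl
  have h1 : 1 < Fintype.card F := Fintype.one_lt_card
  have h2 : 3 ∣ Fintype.card F := hq ▸ dvd_pow_self 3 hn.ne'
  omega

theorem IsInterNumbers.card_eq_of_eq_left (h : IsInterNumbers F α f A B C D) (hAB : A = B) :
    (Fintype.card F : ℤ) = (3 * (C - B) - 1) ^ 2 + 3 := by
  have h0 := h.row₀
  have h1 := h.row₁
  have hq := h.quad
  have hc := h.card
  obtain rfl : D = A + 1 := by linarith
  subst hAB
  linear_combination -hc - 3 * h0 - 9 * hq

theorem IsInterNumbers.card_eq_of_eq_right (h : IsInterNumbers F α f A B C D) (hAC : A = C) :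
    (Fintype.card F : ℤ) = (3 * (B - C) - 1) ^ 2 + 3 := by
  have h0 := h.row₀
  have h1 := h.row₁
  have hq := h.quad
  have hc := h.card
  obtain rfl : D = A + 1 := by linarith
  subst hAC
  linear_combination -hc - 3 * h0 - 9 * hq

theorem IsInterNumbers.card_eq_of_add_two_eq_left (h : IsInterNumbers F α f A B C D)
    (hAB : A + 2 = B) : (Fintype.card F : ℤ) = (3 * (C - B) + 2) ^ 2 + 12 := by
  have h0 := h.row₀
  have h1 := h.row₁
  have hq := h.quad
  have hc := h.card
  obtain rfl : D = A + 1 := by linarith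
  subst hAB
  linear_combination -hc - 3 * h0 - 9 * hq

theorem IsInterNumbers.card_eq_of_add_two_eq_right (h : IsInterNumbers F α f A B C D)
    (hAC : A + 2 = C) : (Fintype.card F : ℤ) = (3 * (B - C) + 2) ^ 2 + 12 := by
  have h0 := h.row₀
  have h1 := h.row₁
  have hq := h.quad
  have hc := h.card
  obtain rfl : D = A + 1 := by linarith
  subst hAC
  linear_combination -hc - 3 * h0 - 9 * hq

/-- If `q` is prime then `4 q = c ^ 2 + 27 d ^ 2` with `c ≡ 1 mod 3` determines the intersection
numbers up to the exchange of `B` and `C`. -/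
theorem IsInterNumbers.eq_of_four_mul_eq (h : IsInterNumbers F α f A B C D)
    (hp : (Fintype.card F).Prime) {k e : ℤ}
    (hq : 4 * (Fintype.card F : ℤ) = (3 * k + 1) ^ 2 + 27 * e ^ 2) :
    9 * A = 3 * k + Fintype.card F - 7 ∧ (C - B = e ∨ C - B = -e) := by
  obtain ⟨h1, h2⟩ := sq_eq_sq_of_four_mul_eq hp h.four_mul_card hq
  refine ⟨?_, sq_eq_sq_iff_eq_or_eq_neg.1 h2⟩
  have hc := h.card
  -- q = 3f + 1 makes 9A - q + 8 ≡ 1 mod 3, so the negative sign cannot occur.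
  rcases sq_eq_sq_iff_eq_or_eq_neg.1 h1 with h1 | h1 <;> omega

theorem strictlyDeza_condition_iff (h3 : 3 ∣ Fintype.card F - 1)
    (h : IsInterNumbers F α f A B C D) :
    (B ≠ C ∧ (A = B ∨ A = C) ∧ 0 < B ∧ 0 < C) ↔
      (Fintype.card F).Prime ∧ Fintype.card F ≠ 7 ∧
        ∃ x : ℤ, (Fintype.card F : ℤ) = x ^ 2 + 3 := by
  have h0 := h.row₀
  have hc := h.card
  constructor
  · rintro ⟨-, hA, hB, hC⟩
    have hx : ∃ x : ℤ, (Fintype.card F : ℤ) = x ^ 2 + 3 := by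
      rcases hA with hA | hA
      · exact ⟨_, h.card_eq_of_eq_left hA⟩
      · exact ⟨_, h.card_eq_of_eq_right hA⟩
    refine ⟨?_, by omega, hx⟩
    obtain ⟨x, hx⟩ := hx
    obtain ⟨p, n, hp, hn, hp3, hq⟩ := exists_prime_pow_eq_card h3
    -- A, B, C > 0 give f ≥ 4, so q ≥ 13; this excludes both 4 and 7.
    have h4 : p ^ n ≠ 4 := by omega
    rw [hq] at hx ⊢
    rw [eq_one_of_pow_eq_sq_add_three hp hn hp3 h4 (by exact_mod_cast hx), pow_one]
    exact hp
  · rintro ⟨hp, h7, x, hx⟩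
    have h4 : Fintype.card F ≠ 4 := fun h4 => by rw [h4] at hp; revert hp; decide
    obtain ⟨e, he⟩ : ∃ e : ℤ, (Fintype.card F : ℤ) = (3 * e - 1) ^ 2 + 3 := by
      have : x % 3 = 0 ∨ x % 3 = 1 ∨ x % 3 = 2 := by omega
      rcases this with hx3 | hx3 | hx3
      · obtain ⟨y, rfl⟩ : ∃ y, x = 3 * y := ⟨x / 3, by omega⟩
        ring_nf at hx
        omega
      · obtain ⟨y, rfl⟩ : ∃ y, x = 3 * y + 1 := ⟨x / 3, by omega⟩
        exact ⟨-y, by rw [hx]; ring⟩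
      · obtain ⟨y, rfl⟩ : ∃ y, x = 3 * y + 2 := ⟨x / 3, by omega⟩
        exact ⟨y + 1, by rw [hx]; ring⟩
    -- 4((3e - 1)² + 3) = (4 - 3e)² + 27e². The values e = 0 and e = 1, where e² - e vanishes,
    -- correspond to q = 4 and q = 7.
    obtain ⟨hA, hd⟩ := h.eq_of_four_mul_eq hp (k := 1 - e) (e := e) (by rw [he]; ring)
    have he0 : e ≠ 0 := by
      rintro rfl
      norm_num at he
      omega
    have he1 : e ≠ 1 := by
      rintro rfl
      norm_num at he
      omega
    have hA' : A = e ^ 2 - e := by linarith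
    have hsum : B + C = 2 * e ^ 2 - e := by linarith
    have hpos : 0 < e ^ 2 - e := by
      rcases lt_or_gt_of_ne he0 with h' | h'
      · nlinarith
      · have : 2 ≤ e := by omega
        nlinarith
    have hpos' : 0 < e ^ 2 := by positivity
    rcases hd with hd | hd
    · have hB : B = e ^ 2 - e := by linarith
      have hC : C = e ^ 2 := by linarith
      exact ⟨by omega, by omega, by omega, by omega⟩
    · have hB : B = e ^ 2 := by linarith
      have hC : C = e ^ 2 - e := by linarith
      exact ⟨by omega, by omega, by omega, by omega⟩

theorem strictlyDeza_bar_condition_iff (h3 : 3 ∣ Fintype.card F - 1)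
    (h : IsInterNumbers F α f A B C D) :
    (B ≠ C ∧ (A + 2 = B ∨ A + 2 = C)) ↔
      (Fintype.card F).Prime ∧ ∃ x : ℤ, (Fintype.card F : ℤ) = x ^ 2 + 12 := by
  have h0 := h.row₀
  have hc := h.card
  constructor
  · rintro ⟨hBC, hA⟩
    obtain ⟨e, he0, he⟩ : ∃ e : ℤ, e ≠ 0 ∧ (Fintype.card F : ℤ) = (3 * e + 2) ^ 2 + 12 := by
      rcases hA with hA | hA
      · exact ⟨C - B, by omega, h.card_eq_of_add_two_eq_left hA⟩
      · exact ⟨B - C, by omega, h.card_eq_of_add_two_eq_right hA⟩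
    refine ⟨?_, _, he⟩
    obtain ⟨p, n, hp, hn, hp3, hq⟩ := exists_prime_pow_eq_card h3
    -- q = 16 would force e = 0, that is B = C, the strongly regular case.
    have h16 : p ^ n ≠ 16 := by
      intro h16
      rw [hq, h16] at he
      have : (3 * e) * (3 * e + 4) = 0 := by push_cast at he; linarith
      rcases mul_eq_zero.1 this with h' | h' <;> omega
    rw [hq] at he ⊢
    rw [eq_one_of_pow_eq_sq_add_twelve hp hn hp3 h16 (by exact_mod_cast he), pow_one]
    exact hp
  · rintro ⟨hp, x, hx⟩
    obtain ⟨e, he⟩ : ∃ e : ℤ, (Fintype.card F : ℤ) = (3 * e + 2) ^ 2 + 12 := by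
      have : x % 3 = 0 ∨ x % 3 = 1 ∨ x % 3 = 2 := by omega
      rcases this with hx3 | hx3 | hx3
      · obtain ⟨y, rfl⟩ : ∃ y, x = 3 * y := ⟨x / 3, by omega⟩
        ring_nf at hx
        omega
      · obtain ⟨y, rfl⟩ : ∃ y, x = 3 * y + 1 := ⟨x / 3, by omega⟩
        exact ⟨-y - 1, by rw [hx]; ring⟩
      · obtain ⟨y, rfl⟩ : ∃ y, x = 3 * y + 2 := ⟨x / 3, by omega⟩
        exact ⟨y, by rw [hx]⟩
    have he0 : e ≠ 0 := by
      rintro rfl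
      have : Fintype.card F = 16 := by
        norm_num at he
        omega
      rw [this] at hp
      revert hp
      norm_num
    -- 4((3e + 2)² + 12) = (3e + 8)² + 27e², and -(3e + 8) is the root congruent to 1 modulo 3.
    obtain ⟨hA, hd⟩ := h.eq_of_four_mul_eq hp (k := -e - 3) (e := e) (by rw [he]; ring)
    have hA' : A = e ^ 2 + e := by linarith
    have hsum : B + C = 2 * e ^ 2 + 3 * e + 4 := by linarith
    rcases hd with hd | hd
    · exact ⟨by omega, Or.inl (by linarith)⟩
    · exact ⟨by omega, Or.inr (by linarith)⟩

end Main

end DezaCyclotomic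

open DezaCyclotomic in
theorem theorem1 {F : Type*} [Field F] [Fintype F] (h3 : 3 ∣ Fintype.card F - 1)
    (α : Fˣ) (hα : ∀ u : Fˣ, u ∈ Subgroup.zpowers α) :
    -- the graphs are Cayley graphs; the connection sets generate, except for `Γ_i` with `q = 4`
    (∀ i ∈ ({1, 2, 3} : Set ℕ),
      IsCayleyGraph (Gam α hα i) (cyclotomicCoset α 3 i) ∧
      (Fintype.card F ≠ 4 → AddSubgroup.closure (cyclotomicCoset α 3 i) = ⊤) ∧
      IsCayleyGraph (GamBar α hα i) ({0}ᶜ \ cyclotomicCoset α 3 i) ∧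
      AddSubgroup.closure ({0}ᶜ \ cyclotomicCoset α 3 i) = ⊤) ∧
    -- the three graphs `Γ_i` are isomorphic, and so are the three graphs `Γ̄_i`
    (∀ i ∈ ({1, 2, 3} : Set ℕ), ∀ j ∈ ({1, 2, 3} : Set ℕ),
      Nonempty (Gam α hα i ≃g Gam α hα j)) ∧
    (∀ i ∈ ({1, 2, 3} : Set ℕ), ∀ j ∈ ({1, 2, 3} : Set ℕ),
      Nonempty (GamBar α hα i ≃g GamBar α hα j)) ∧
    -- the strictly Deza graphs
    (IsStrictlyDeza (Gam α hα 1) ↔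
      (Fintype.card F).Prime ∧ Fintype.card F ≠ 7 ∧
        ∃ x : ℤ, (Fintype.card F : ℤ) = x ^ 2 + 3) ∧
    (IsStrictlyDeza (GamBar α hα 3) ↔
      (Fintype.card F).Prime ∧ ∃ x : ℤ, (Fintype.card F : ℤ) = x ^ 2 + 12) := by
  obtain ⟨f, A, B, C, D, h⟩ := exists_isInterNumbers h3 hα
  have hne : ∀ i ∈ ({1, 2, 3} : Set ℕ), i ≠ 0 := by
    rintro i hi rfl
    simp at hi
  exact ⟨fun i hi => ⟨isCayleyGraph_Gam hα (hne i hi),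
      fun h4 => closure_cyclotomicCoset h3 hα h4 i, isCayleyGraph_GamBar h3 hα hi,
      closure_compl_diff_cyclotomicCoset h3 hα hi⟩,
    fun i hi j hj => nonempty_Gam_iso h3 hα (hne i hi) (hne j hj),
    fun i hi j hj => nonempty_GamBar_iso h3 hα hi hj,
    (isStrictlyDeza_Gam_iff h3 hα h).trans (strictlyDeza_condition_iff h3 h),
    (isStrictlyDeza_GamBar_iff h3 hα h).trans (strictlyDeza_bar_condition_iff h3 h)⟩
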